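/- Let $R$ and $S$ be associative rings with unit; "module" means left module, and right $R$-modules are modules over $R^{op}$. Let $d\ge 1$ and $n>d+1$ be integers. A module $U$ is finitely $n$-presented if there is an exact sequence $F_n\to\cdots\to F_1\to F_0\to U\to 0$ with all $F_i$ finitely generated free, and super finitely presented if there is an infinite exact sequence $\cdots\to F_1\to F_0\to U\to 0$ with all $F_i$ finitely generated free; the $i$th syzygy of $U$ in the latter sequence is $\operatorname{Ker}(F_i\to F_{i-1})$, where $F_{-1}=U$. An $S$-module $M$ is $(n,d)$-injective if $\operatorname{Ext}_S^{d+1}(U,M)=0$ for every finitely $n$-presented $S$-module $U$, and an $R$-module $N$ is $(n,d)$-flat if $\operatorname{Tor}^R_{d+1}(U,N)=0$ for every finitely $n$-presented right $R$-module $U$. An $(S,R)$-bimodule $K$ is semidualizing if ${}_SK$ and $K_R$ have projective resolutions by finitely generated modules, the homothety maps $S\to\operatorname{Hom}_{R^{op}}(K,K)$ and $R\to\operatorname{Hom}_S(K,K)$ are bijective, and $\operatorname{Ext}_S^i(K,K)=0=\operatorname{Ext}_{R^{op}}^i(K,K)$ for all $i\ge 1$. Let $C$ be an $(S,R)$-bimodule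 that is super finitely presented on either side, and let $K_{d-1}$ be a semidualizing $(S,R)$-bimodule that is a $(d-1)$th syzygy of $C$ on either side, i.e. that is isomorphic as an $S$-module to the $(d-1)$th syzygy of ${}_SC$ in some resolution by finitely generated free $S$-modules, and as a right $R$-module to the $(d-1)$th syzygy of $C_R$ in some resolution by finitely generated free right $R$-modules. Write $K=K_{d-1}$. Then: (1) Every $(n,d)$-injective $S$-module $M$ lies in the Bass class $\mathcal{B}_{K}(S)$: $\operatorname{Ext}_S^i(K,M)=0$ and $\operatorname{Tor}^R_i(K,\operatorname{Hom}_S(K,M))=0$ for all $i\ge 1$, and the evaluation map $K\otimes_R\operatorname{Hom}_S(K,M)\to M$ is an isomorphism. (2) Every $(n,d)$-flat $R$-module $N$ lies in the Auslander class $\mathcal{A}_{K}(R)$: $\operatorname{Tor}^R_i(K,N)=0$ and $\operatorname{Ext}_S^i(K,K\otimes_R N)=0$ for all $i\ge 1$, and the natural map $N\to\operatorname{Hom}_S(K,K\otimes_R N)$ is an isomorphism. -/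

import Mathlib

open CategoryTheory MulOpposite
open scoped TensorProduct

universe u

noncomputable section

/-! Conventions: `R` and `S` are associative unital rings, "module" means left module, and a right
`R`-module is a module over `Rᵐᵒᵖ`, with `m · r = op r • m`. An `(S, R)`-bimodule is an abelian
group with commuting actions of `S` and of `Rᵐᵒᵖ`. -/

/-! ### The tensor product over a noncommutative ring -/

/-- The subgroup of `A ⊗ M` (over `ℤ`) generated by all `(a · r) ⊗ m - a ⊗ (r m)`. -/
def balancedRel (R : Type u) [Ring R] (A M : Type u) [AddCommGroup A] [Module Rᵐᵒᵖ A]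
    [AddCommGroup M] [Module R M] : Submodule ℤ (A ⊗[ℤ] M) :=
  Submodule.span ℤ {x | ∃ (a : A) (r : R) (m : M), x = (op r • a) ⊗ₜ[ℤ] m - a ⊗ₜ[ℤ] (r • m)}

/-- The tensor product `A ⊗_R M` of a right `R`-module `A` and a left `R`-module `M`. -/
def BalTensor (R : Type u) [Ring R] (A M : Type u) [AddCommGroup A] [Module Rᵐᵒᵖ A]
    [AddCommGroup M] [Module R M] : Type u :=
  (A ⊗[ℤ] M) ⧸ balancedRel R A M

namespace BalTensor

section Basic

variable {R : Type u} [Ring R] {A B D M : Type u}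
  [AddCommGroup A] [Module Rᵐᵒᵖ A] [AddCommGroup B] [Module Rᵐᵒᵖ B]
  [AddCommGroup D] [Module Rᵐᵒᵖ D] [AddCommGroup M] [Module R M]

instance : AddCommGroup (BalTensor R A M) :=
  inferInstanceAs (AddCommGroup ((A ⊗[ℤ] M) ⧸ balancedRel R A M))

/-- The pure tensor `a ⊗ m` in `A ⊗_R M`. -/
def tmul (R : Type u) [Ring R] {A M : Type u} [AddCommGroup A] [Module Rᵐᵒᵖ A]
    [AddCommGroup M] [Module R M] (a : A) (m : M) : BalTensor R A M :=
  (balancedRel R A M).mkQ (a ⊗ₜ[ℤ] m)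

theorem add_tmul (a b : A) (m : M) : tmul R (a + b) m = tmul R a m + tmul R b m := by
  unfold tmul; rw [TensorProduct.add_tmul, map_add]; rfl

theorem tmul_add (a : A) (m n : M) : tmul R a (m + n) = tmul R a m + tmul R a n := by
  unfold tmul; rw [TensorProduct.tmul_add, map_add]; rfl

theorem op_smul_tmul (r : R) (a : A) (m : M) : tmul R (op r • a) m = tmul R a (r • m) := by
  refine (Submodule.Quotient.eq _).2 ?_
  exact Submodule.subset_span ⟨a, r, m, rfl⟩

@[elab_as_elim]
theorem induction_on {p : BalTensor R A M → Prop} (x : BalTensor R A M) (h0 : p 0)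
    (ht : ∀ a m, p (tmul R a m)) (ha : ∀ x y, p x → p y → p (x + y)) : p x := by
  obtain ⟨y, rfl⟩ := (balancedRel R A M).mkQ_surjective x
  induction y using TensorProduct.induction_on with
  | zero => rw [map_zero]; exact h0
  | tmul a m => exact ht a m
  | add x y hx hy => rw [map_add]; exact ha _ _ hx hy

/-- The additive map out of `A ⊗_R M` given by a biadditive `R`-balanced map. -/
def lift {P : Type u} [AddCommGroup P] (f : A →+ M →+ P)
    (hf : ∀ (r : R) (a : A) (m : M), f (op r • a) m = f a (r • m)) : BalTensor R A M →+ P :=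
  ((balancedRel R A M).liftQ
    (TensorProduct.lift (LinearMap.mk₂ ℤ (fun a m => f a m) (by simp) (by simp)
      (by simp) (by simp)))
    (by
      refine Submodule.span_le.2 ?_
      rintro _ ⟨a, r, m, rfl⟩
      change TensorProduct.lift _ _ = 0
      rw [map_sub, TensorProduct.lift.tmul, TensorProduct.lift.tmul, LinearMap.mk₂_apply,
        LinearMap.mk₂_apply, hf, sub_self])).toAddMonoidHom

@[simp]
theorem lift_tmul {P : Type u} [AddCommGroup P] (f : A →+ M →+ P)
    (hf : ∀ (r : R) (a : A) (m : M), f (op r • a) m = f a (r • m)) (a : A) (m : M) :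
    lift f hf (tmul R a m) = f a m := rfl

theorem hom_ext {P : Type u} [AddCommGroup P] {f g : BalTensor R A M →+ P}
    (h : ∀ a m, f (tmul R a m) = g (tmul R a m)) : f = g := by
  ext x
  induction x using induction_on with
  | h0 => simp
  | ht a m => exact h a m
  | ha x y hx hy => rw [map_add, map_add, hx, hy]

/-- The map `g ⊗ id : A ⊗_R M → B ⊗_R M` for a map `g` of right `R`-modules. -/
def map (M : Type u) [AddCommGroup M] [Module R M] (g : A →ₗ[Rᵐᵒᵖ] B) :
    BalTensor R A M →+ BalTensor R B M :=
  lift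
    (AddMonoidHom.mk' (fun a => AddMonoidHom.mk' (fun m => tmul R (g a) m)
        (fun m n => tmul_add _ m n))
      (fun a b => by ext m; simp [add_tmul]))
    (fun r a m => by simp [op_smul_tmul])

@[simp]
theorem map_tmul (g : A →ₗ[Rᵐᵒᵖ] B) (a : A) (m : M) :
    map M g (tmul R a m) = tmul R (g a) m := rfl

theorem map_id : map M (LinearMap.id : A →ₗ[Rᵐᵒᵖ] A) = AddMonoidHom.id _ :=
  hom_ext fun _ _ => rfl

theorem map_comp (h : B →ₗ[Rᵐᵒᵖ] D) (g : A →ₗ[Rᵐᵒᵖ] B) :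
    map M (h.comp g) = (map M h).comp (map M g) :=
  hom_ext fun _ _ => rfl

theorem map_add_left (g h : A →ₗ[Rᵐᵒᵖ] B) : map M (g + h) = map M g + map M h :=
  hom_ext fun a m => by
    rw [AddMonoidHom.add_apply, map_tmul, map_tmul, map_tmul, LinearMap.add_apply, add_tmul]

end Basic

/-- If `K` is an `(S, R)`-bimodule then `K ⊗_R M` is a left `S`-module, by `s (k ⊗ m) = sk ⊗ m`. -/
instance instModuleLeft {R S : Type u} [Ring R] [Ring S] {K M : Type u}
    [AddCommGroup K] [Module S K] [Module Rᵐᵒᵖ K] [SMulCommClass S Rᵐᵒᵖ K]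
    [AddCommGroup M] [Module R M] : Module S (BalTensor R K M) where
  smul s := map M (Module.toModuleEnd Rᵐᵒᵖ K s)
  one_smul x := by
    change map M (Module.toModuleEnd Rᵐᵒᵖ K (1 : S)) x = x
    rw [map_one]; exact DFunLike.congr_fun map_id x
  mul_smul s t x := by
    change map M (Module.toModuleEnd Rᵐᵒᵖ K (s * t)) x = map M _ (map M _ x)
    rw [map_mul]; exact DFunLike.congr_fun (map_comp _ _) x
  smul_zero s := _root_.map_zero (map M (Module.toModuleEnd Rᵐᵒᵖ K s))
  smul_add s := _root_.map_add (map M (Module.toModuleEnd Rᵐᵒᵖ K s))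
  add_smul s t x := by
    change map M (Module.toModuleEnd Rᵐᵒᵖ K (s + t)) x = map M _ x + map M _ x
    rw [_root_.map_add, map_add_left]; rfl
  zero_smul x := by
    change map M (Module.toModuleEnd Rᵐᵒᵖ K (0 : S)) x = 0
    rw [_root_.map_zero]
    induction x using induction_on with
    | h0 => exact _root_.map_zero _
    | ht a m =>
      rw [map_tmul]
      exact (add_eq_left (a := tmul R (0 : K) m)).1 (by rw [← add_tmul, zero_add]; rfl)
    | ha x y hx hy => rw [_root_.map_add, hx, hy, add_zero]

theorem smul_tmul {R S : Type u} [Ring R] [Ring S] {K M : Type u}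
    [AddCommGroup K] [Module S K] [Module Rᵐᵒᵖ K] [SMulCommClass S Rᵐᵒᵖ K]
    [AddCommGroup M] [Module R M] (s : S) (k : K) (m : M) :
    s • tmul R k m = tmul R (s • k) m := rfl

end BalTensor

/-- The functor `- ⊗_R M` from right `R`-modules to abelian groups. -/
def balTensorFunctor (R : Type u) [Ring R] (M : Type u) [AddCommGroup M] [Module R M] :
    ModuleCat.{u} Rᵐᵒᵖ ⥤ AddCommGrpCat.{u} where
  obj A := AddCommGrpCat.of (BalTensor R A M)
  map g := AddCommGrpCat.ofHom (BalTensor.map M g.hom)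
  map_id A := by
    ext x; exact DFunLike.congr_fun BalTensor.map_id x
  map_comp g h := by
    ext x; exact DFunLike.congr_fun (BalTensor.map_comp h.hom g.hom) x

instance (R : Type u) [Ring R] (M : Type u) [AddCommGroup M] [Module R M] :
    (balTensorFunctor R M).Additive where
  map_add {A B g h} := by
    ext x; exact DFunLike.congr_fun (BalTensor.map_add_left g.hom h.hom) x

/-- `Tor_i^R(A, M)` for a right `R`-module `A` and a left `R`-module `M`: the `i`-th left derived
functor of `- ⊗_R M`, evaluated at `A`. -/
def TorGroup (R : Type u) [Ring R] (i : ℕ) (A M : Type u) [AddCommGroup A] [Module Rᵐᵒᵖ A]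
    [AddCommGroup M] [Module R M] : AddCommGrpCat.{u} :=
  ((balTensorFunctor R M).leftDerived i).obj (ModuleCat.of Rᵐᵒᵖ A)

/-- `Ext_A^i(M, N)` for left modules `M`, `N` over a ring `A`. -/
abbrev ExtGroup (A : Type u) [Ring A] (i : ℕ) (M N : Type u) [AddCommGroup M] [Module A M]
    [AddCommGroup N] [Module A N] : Type u :=
  Abelian.Ext (ModuleCat.of A M) (ModuleCat.of A N) i

/-! ### Homomorphisms out of a bimodule -/

/-- `Hom_S(K, N)` for an `(S, R)`-bimodule `K` and a left `S`-module `N`, to be regarded as a left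
`R`-module by `(r f)(k) = f(k · r)`. -/
def BimodHom (R S K N : Type u) [Ring R] [Ring S] [AddCommGroup K] [Module S K] [Module Rᵐᵒᵖ K]
    [SMulCommClass S Rᵐᵒᵖ K] [AddCommGroup N] [Module S N] : Type u :=
  K →ₗ[S] N

namespace BimodHom

variable {R S K N : Type u} [Ring R] [Ring S] [AddCommGroup K] [Module S K] [Module Rᵐᵒᵖ K]
  [SMulCommClass S Rᵐᵒᵖ K] [AddCommGroup N] [Module S N]

instance : AddCommGroup (BimodHom R S K N) := inferInstanceAs (AddCommGroup (K →ₗ[S] N))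

instance : FunLike (BimodHom R S K N) K N := inferInstanceAs (FunLike (K →ₗ[S] N) K N)

instance : LinearMapClass (BimodHom R S K N) S K N :=
  inferInstanceAs (LinearMapClass (K →ₗ[S] N) S K N)

@[ext]
theorem ext {f g : BimodHom R S K N} (h : ∀ k, f k = g k) : f = g := DFunLike.ext _ _ h

theorem add_apply (f g : BimodHom R S K N) (k : K) : (f + g) k = f k + g k := rfl

instance : Module R (BimodHom R S K N) where
  smul r f := LinearMap.comp f
    (haveI := SMulCommClass.symm S Rᵐᵒᵖ K; Module.toModuleEnd S K (op r))
  one_smul f := ext fun k => congrArg f (one_smul Rᵐᵒᵖ k)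
  mul_smul r t f := ext fun k => congrArg f (mul_smul (op t) (op r) k)
  smul_zero _ := rfl
  smul_add _ _ _ := rfl
  add_smul r t f := ext fun k =>
    (congrArg f (add_smul (op r) (op t) k)).trans (_root_.map_add f _ _)
  zero_smul f := ext fun k => (congrArg f (zero_smul Rᵐᵒᵖ k)).trans (_root_.map_zero f)

theorem smul_apply (r : R) (f : BimodHom R S K N) (k : K) : (r • f) k = f (op r • k) := rfl

end BimodHom

section Evaluation

variable (R S K : Type u) [Ring R] [Ring S] [AddCommGroup K] [Module S K] [Module Rᵐᵒᵖ K]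
  [SMulCommClass S Rᵐᵒᵖ K]

/-- The natural map `μ_M : M → Hom_S(K, K ⊗_R M)`, `m ↦ (k ↦ k ⊗ m)`, of left `R`-modules. -/
def auslanderMap (M : Type u) [AddCommGroup M] [Module R M] :
    M →ₗ[R] BimodHom R S K (BalTensor R K M) where
  toFun m :=
    ({ toFun := fun k => BalTensor.tmul R k m
       map_add' := fun k l => BalTensor.add_tmul k l m
       map_smul' := fun _ _ => rfl } : K →ₗ[S] BalTensor R K M)
  map_add' m m' := BimodHom.ext fun k => BalTensor.tmul_add k m m'
  map_smul' r m := BimodHom.ext fun k => (BalTensor.op_smul_tmul r k m).symm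

/-- The natural map `ν_N : K ⊗_R Hom_S(K, N) → N`, `k ⊗ f ↦ f k`, of left `S`-modules. -/
def bassMap (N : Type u) [AddCommGroup N] [Module S N] :
    BalTensor R K (BimodHom R S K N) →ₗ[S] N where
  toFun := BalTensor.lift
    (AddMonoidHom.mk' (fun k => AddMonoidHom.mk' (fun f : BimodHom R S K N => f k)
        (fun f g => BimodHom.add_apply f g k))
      (fun k l => by ext f; exact map_add f k l))
    (fun _ _ _ => rfl)
  map_add' := map_add _
  map_smul' s x := by
    induction x using BalTensor.induction_on with
    | h0 => simp
    | ht k f => exact map_smul f s k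
    | ha x y hx hy => rw [smul_add, map_add, hx, hy, map_add, smul_add]

/-! ### The Auslander and Bass classes -/

/-- Membership of a left `R`-module `M` in the Auslander class `𝒜_K(R)`. -/
structure MemAuslander (M : Type u) [AddCommGroup M] [Module R M] : Prop where
  tor_zero : ∀ i : ℕ, 1 ≤ i → Limits.IsZero (TorGroup R i K M)
  ext_zero : ∀ i : ℕ, 1 ≤ i → Subsingleton (ExtGroup S i K (BalTensor R K M))
  bijective : Function.Bijective (auslanderMap R S K M)

/-- Membership of a left `S`-module `N` in the Bass class `ℬ_K(S)`. -/
structure MemBass (N : Type u) [AddCommGroup N] [Module S N] : Prop where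
  ext_zero : ∀ i : ℕ, 1 ≤ i → Subsingleton (ExtGroup S i K N)
  tor_zero : ∀ i : ℕ, 1 ≤ i → Limits.IsZero (TorGroup R i K (BimodHom R S K N))
  bijective : Function.Bijective (bassMap R S K N)

end Evaluation

/-! ### Finiteness conditions -/

/-- `U` is finitely `n`-presented: there is an exact sequence `F_n → ⋯ → F_1 → F_0 → U → 0` with
every `F_i` finitely generated and free. (The terms of index greater than `n` are irrelevant.) -/
def IsFinitelyNPresented (A : Type u) [Ring A] (n : ℕ) (U : Type u) [AddCommGroup U] [Module A U] :
    Prop :=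
  ∃ (F : ℕ → ModuleCat.{u} A) (ε : F 0 →ₗ[A] U) (δ : ∀ i, F (i + 1) →ₗ[A] F i),
    (∀ i, i ≤ n → Module.Finite A (F i) ∧ Module.Free A (F i)) ∧
    Function.Surjective ε ∧
    (1 ≤ n → Function.Exact (δ 0) ε) ∧
    ∀ i, i + 2 ≤ n → Function.Exact (δ (i + 1)) (δ i)

/-- An exact sequence `⋯ → F_2 → F_1 → F_0 → U → 0` with every `F_i` finitely generated and free;
a module is super finitely presented if it has one. -/
structure FinFreeResolution (A : Type u) [Ring A] (U : Type u) [AddCommGroup U] [Module A U] where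
  /-- the terms `F_i` -/
  F : ℕ → ModuleCat.{u} A
  finite : ∀ i, Module.Finite A (F i)
  free : ∀ i, Module.Free A (F i)
  /-- the augmentation `F_0 → U` -/
  ε : F 0 →ₗ[A] U
  /-- the differentials `F_{i+1} → F_i` -/
  δ : ∀ i, F (i + 1) →ₗ[A] F i
  surjective : Function.Surjective ε
  exact_zero : Function.Exact (δ 0) ε
  exact_succ : ∀ i, Function.Exact (δ (i + 1)) (δ i)

/-- The `i`-th syzygy `K_i = Ker (F_i → F_{i-1})`, where `F_{-1} = U`. -/
def FinFreeResolution.syzygy {A : Type u} [Ring A] {U : Type u} [AddCommGroup U] [Module A U]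
    (P : FinFreeResolution A U) : ∀ i : ℕ, Submodule A (P.F i)
  | 0 => LinearMap.ker P.ε
  | i + 1 => LinearMap.ker (P.δ i)

/-- `U` has a projective resolution all of whose terms are finitely generated. -/
def HasFiniteProjectiveResolution (A : Type u) [Ring A] (U : Type u) [AddCommGroup U]
    [Module A U] : Prop :=
  ∃ P : ProjectiveResolution (ModuleCat.of A U), ∀ i, Module.Finite A (P.complex.X i)

/-! ### Semidualizing bimodules -/

section Semidualizing

variable (R S : Type u) [Ring R] [Ring S]

/-- The `(S, R)`-bimodule `K` is semidualizing. -/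
structure IsSemidualizing (K : Type u) [AddCommGroup K] [Module S K] [Module Rᵐᵒᵖ K]
    [SMulCommClass S Rᵐᵒᵖ K] : Prop where
  left_resolution : HasFiniteProjectiveResolution S K
  right_resolution : HasFiniteProjectiveResolution Rᵐᵒᵖ K
  /-- `S → Hom_{Rᵒᵖ}(K, K)`, `s ↦ (k ↦ s k)`, is an isomorphism. -/
  left_homothety : Function.Bijective (Module.toModuleEnd Rᵐᵒᵖ K : S →+* Module.End Rᵐᵒᵖ K)
  /-- `R → Hom_S(K, K)`, `r ↦ (k ↦ k · r)`, is an isomorphism. -/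
  right_homothety :
    haveI := SMulCommClass.symm S Rᵐᵒᵖ K
    Function.Bijective (Module.toModuleEnd S K : Rᵐᵒᵖ →+* Module.End S K)
  left_ext : ∀ i : ℕ, 1 ≤ i → Subsingleton (ExtGroup S i K K)
  right_ext : ∀ i : ℕ, 1 ≤ i → Subsingleton (ExtGroup Rᵐᵒᵖ i K K)

/-- `K = K_{d-1}` is special semidualizing with respect to the super finitely presented
`(S, R)`-bimodule `C` (for `d ≥ 1`): it is a semidualizing bimodule and it is the `(d-1)`-th syzygy
of `C`, over `S` as well as over `Rᵐᵒᵖ`. If `K` is the `(d-1)`-th syzygy in an exact sequence of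
bimodules `⋯ → F_1 → F_0 → C → 0` whose terms are finitely generated and free on either side, then
this one sequence serves as `P` and as `Q`; the two may however be different. -/
structure IsSpecialSemidualizing (d : ℕ) (C K : Type u)
    [AddCommGroup C] [Module S C] [Module Rᵐᵒᵖ C] [SMulCommClass S Rᵐᵒᵖ C]
    [AddCommGroup K] [Module S K] [Module Rᵐᵒᵖ K] [SMulCommClass S Rᵐᵒᵖ K] : Prop where
  left_syzygy : ∃ P : FinFreeResolution S C, Nonempty (K ≃ₗ[S] P.syzygy (d - 1))
  right_syzygy : ∃ Q : FinFreeResolution Rᵐᵒᵖ C, Nonempty (K ≃ₗ[Rᵐᵒᵖ] Q.syzygy (d - 1))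
  semidualizing : IsSemidualizing R S K

end Semidualizing

/-! ### `(n, d)`-injective and `(n, d)`-flat modules -/

/-- The left `S`-module `M` is `(n, d)`-injective: `Ext_S^{d+1}(U, M) = 0` for all finitely
`n`-presented left `S`-modules `U`. -/
def IsNDInjective (S : Type u) [Ring S] (n d : ℕ) (M : Type u) [AddCommGroup M] [Module S M] :
    Prop :=
  ∀ (U : Type u) [AddCommGroup U] [Module S U], IsFinitelyNPresented S n U →
    Subsingleton (ExtGroup S (d + 1) U M)

/-- The left `R`-module `N` is `(n, d)`-flat (`n ≥ 1`): `Tor_{d+1}^R(U, N) = 0` for all finitely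
`n`-presented right `R`-modules `U`. -/
def IsNDFlat (R : Type u) [Ring R] (n d : ℕ) (N : Type u) [AddCommGroup N] [Module R N] : Prop :=
  ∀ (U : Type u) [AddCommGroup U] [Module Rᵐᵒᵖ U], IsFinitelyNPresented Rᵐᵒᵖ n U →
    Limits.IsZero (TorGroup R (d + 1) U N)

end

/-! Write X* for the `K`-dual of X, and call X good if it has a resolution by finitely generated
free modules, all Ext^i(X, K) with i ≥ 1 vanish, and X* is finitely n-presented for every n
(`HasFinPresentedDual`). K itself is good: K* = Hom(K, K) is the ring on the other side. If F → X is
onto with F the first term of such a resolution and L is the kernel, then 0 → X* → F* → L* → 0 is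
exact with F* a finite power of K, so L is good again.

Let M be (n,d)-injective. Shifting along the resolution of C gives Ext^i(K, M) = Ext^(i+d)(C, M) = 0
for i ≥ 1. Hence Ext^i(F*, M) = 0 in the dual sequences, and Ext^i(X*, M) embeds into Ext^(i+1)(L*,
M). Passing to further kernels raises the degree to d+1, where the Ext group vanishes because the
dual in question is finitely n-presented. So Ext^1(X*, M) = 0 for every good X
(`subsingleton_ext_dual`), and Hom(-, M) is exact on all dual sequences.

Bass class: the natural map X ⊗ Hom(K, M) → Hom(X*, M) is bijective for X finitely generated free,
and diagram chases along 0 → L → F → X → 0 extend this to good X. They also show that L ⊗ Hom(K, M)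
→ F ⊗ Hom(K, M) is injective, which is the vanishing of Tor. For X = K the natural map is the
evaluation map.

Auslander class: Tor(-, N) and Ext into the character module N⁺ vanish together
(`isZero_tor_succ_iff`), so N⁺ is (n,d)-injective and the same argument gives Ext^1(X*, N⁺) = 0.
Thus - ⊗ N is exact on dual sequences, and X* ⊗ N → Hom(X, K ⊗ N) is compared on free and then on
good modules. -/

/-- Left exactness of Hom(-, M): `g` is a cokernel of `f`. -/
theorem LinearMap.exists_comp_eq_of_exact {A X Y Z M : Type*} [Ring A] [AddCommGroup X] [Module A X]
    [AddCommGroup Y] [Module A Y] [AddCommGroup Z] [Module A Z] [AddCommGroup M] [Module A M]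
    {f : X →ₗ[A] Y} {g : Y →ₗ[A] Z} (hfg : Function.Exact f g) (hg : Function.Surjective g)
    {φ : Y →ₗ[A] M} (hφ : φ.comp f = 0) : ∃ ψ : Z →ₗ[A] M, ψ.comp g = φ := by
  have hker : LinearMap.ker g ≤ LinearMap.ker φ := fun y hy => by
    obtain ⟨x, rfl⟩ := (hfg y).1 hy
    exact DFunLike.congr_fun hφ x
  exact ⟨((LinearMap.ker g).liftQ φ hker).comp (g.quotKerEquivOfSurjective hg).symm.toLinearMap,
    LinearMap.ext fun y => by
      rw [LinearMap.comp_apply, LinearMap.comp_apply, LinearEquiv.coe_coe,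
        show (g.quotKerEquivOfSurjective hg).symm (g y) = (LinearMap.ker g).mkQ y from
          (LinearEquiv.symm_apply_eq _).2 rfl]
      rfl⟩

/-! ### Vanishing of `Ext` along short exact sequences -/

section ExtVanishing

variable {A : Type u} [Ring A] {X Y Z M : Type u} [AddCommGroup X] [Module A X]
  [AddCommGroup Y] [Module A Y] [AddCommGroup Z] [Module A Z] [AddCommGroup M] [Module A M]

theorem subsingleton_ext_of_projective (X M : Type u) [AddCommGroup X] [Module A X]
    [Module.Projective A X] [AddCommGroup M] [Module A M] {i : ℕ} (hi : 1 ≤ i) :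
    Subsingleton (ExtGroup A i X M) := by
  obtain ⟨j, rfl⟩ := Nat.exists_eq_add_of_le' hi
  have : Projective (ModuleCat.of A X) := (IsProjective.iff_projective X).1 inferInstance
  exact Abelian.Ext.subsingleton_of_projective _ _ _

theorem shortExact_of_linearMaps {f : X →ₗ[A] Y} {g : Y →ₗ[A] Z} (hf : Function.Injective f)
    (hfg : Function.Exact f g) (hg : Function.Surjective g) :
    (ShortComplex.mk (ModuleCat.ofHom f) (ModuleCat.ofHom g)
      (ModuleCat.hom_ext hfg.linearMap_comp_eq_zero)).ShortExact :=
  ModuleCat.shortComplex_shortExact _ hfg hf hg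

theorem subsingleton_ext_left {f : X →ₗ[A] Y} {g : Y →ₗ[A] Z} (hf : Function.Injective f)
    (hfg : Function.Exact f g) (hg : Function.Surjective g) {i : ℕ}
    (hY : Subsingleton (ExtGroup A i Y M)) (hZ : Subsingleton (ExtGroup A (i + 1) Z M)) :
    Subsingleton (ExtGroup A i X M) := by
  refine subsingleton_of_forall_eq 0 fun x => ?_
  obtain ⟨y, rfl⟩ := Abelian.Ext.contravariant_sequence_exact₁ (shortExact_of_linearMaps hf hfg hg)
    (ModuleCat.of A M) x (add_comm 1 i) (hZ.elim _ _)
  rw [show y = 0 from hY.elim _ _, Abelian.Ext.comp_zero]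

theorem subsingleton_ext_middle {f : X →ₗ[A] Y} {g : Y →ₗ[A] Z} (hf : Function.Injective f)
    (hfg : Function.Exact f g) (hg : Function.Surjective g) {i : ℕ}
    (hX : Subsingleton (ExtGroup A i X M)) (hZ : Subsingleton (ExtGroup A i Z M)) :
    Subsingleton (ExtGroup A i Y M) := by
  refine subsingleton_of_forall_eq 0 fun y => ?_
  obtain ⟨z, rfl⟩ := Abelian.Ext.contravariant_sequence_exact₂ (shortExact_of_linearMaps hf hfg hg)
    (ModuleCat.of A M) y (hX.elim _ _)
  rw [show z = 0 from hZ.elim _ _, Abelian.Ext.comp_zero]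

theorem subsingleton_ext_right {f : X →ₗ[A] Y} {g : Y →ₗ[A] Z} (hf : Function.Injective f)
    (hfg : Function.Exact f g) (hg : Function.Surjective g) {i : ℕ}
    (hX : Subsingleton (ExtGroup A i X M)) (hY : Subsingleton (ExtGroup A (i + 1) Y M)) :
    Subsingleton (ExtGroup A (i + 1) Z M) := by
  refine subsingleton_of_forall_eq 0 fun z => ?_
  obtain ⟨x, rfl⟩ := Abelian.Ext.contravariant_sequence_exact₃ (shortExact_of_linearMaps hf hfg hg)
    (ModuleCat.of A M) z (hY.elim _ _) (add_comm 1 i)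
  rw [show x = 0 from hX.elim _ _, Abelian.Ext.comp_zero]

theorem exists_extension_of_subsingleton_ext {f : X →ₗ[A] Y} {g : Y →ₗ[A] Z}
    (hf : Function.Injective f) (hfg : Function.Exact f g) (hg : Function.Surjective g)
    (hZ : Subsingleton (ExtGroup A 1 Z M)) (φ : X →ₗ[A] M) : ∃ ψ : Y →ₗ[A] M, ψ.comp f = φ := by
  obtain ⟨y, hy⟩ := Abelian.Ext.contravariant_sequence_exact₁ (shortExact_of_linearMaps hf hfg hg)
    (ModuleCat.of A M) (Abelian.Ext.mk₀ (ModuleCat.ofHom φ)) (add_comm 1 0) (hZ.elim _ _)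
  obtain ⟨ψ, rfl⟩ := Abelian.Ext.addEquiv₀.symm.surjective y
  refine ⟨ψ.hom, ?_⟩
  rw [Abelian.Ext.addEquiv₀_symm_apply, Abelian.Ext.mk₀_comp_mk₀] at hy
  exact congrArg ModuleCat.Hom.hom ((Abelian.Ext.mk₀_bijective _ _).1 hy)

/-- The connecting map Hom(X, M) → Ext^1(Z, M) is onto because Ext^1(Y, M) = 0, and it kills every
map that extends to Y. -/
theorem subsingleton_ext_one_of_exists_extension {f : X →ₗ[A] Y} {g : Y →ₗ[A] Z}
    (hf : Function.Injective f) (hfg : Function.Exact f g) (hg : Function.Surjective g)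
    (hY : Subsingleton (ExtGroup A 1 Y M))
    (h : ∀ φ : X →ₗ[A] M, ∃ ψ : Y →ₗ[A] M, ψ.comp f = φ) : Subsingleton (ExtGroup A 1 Z M) := by
  refine subsingleton_of_forall_eq 0 fun z => ?_
  have hS := shortExact_of_linearMaps hf hfg hg
  obtain ⟨x, rfl⟩ := Abelian.Ext.contravariant_sequence_exact₃ hS
    (ModuleCat.of A M) z (hY.elim _ _) (add_comm 1 0)
  obtain ⟨φ, rfl⟩ := Abelian.Ext.addEquiv₀.symm.surjective x
  obtain ⟨ψ, hψ⟩ := h φ.hom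
  have : φ = (ModuleCat.ofHom f) ≫ ModuleCat.ofHom ψ := ModuleCat.hom_ext hψ.symm
  rw [Abelian.Ext.addEquiv₀_symm_apply, this, ← Abelian.Ext.mk₀_comp_mk₀]
  exact hS.extClass_comp_assoc _

theorem subsingleton_ext_congr (e : X ≃ₗ[A] Y) {i : ℕ} (hi : 1 ≤ i)
    (hX : Subsingleton (ExtGroup A i X M)) : Subsingleton (ExtGroup A i Y M) :=
  -- An isomorphism is a short exact sequence with zero left term.
  subsingleton_ext_middle (X := PUnit.{u + 1}) (f := 0) (g := e.symm.toLinearMap)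
    (fun _ _ _ => rfl) (fun y => by simp [eq_comm (a := (0 : Y))]) e.symm.surjective
    (subsingleton_ext_of_projective _ _ hi) hX

theorem subsingleton_ext_pi {i : ℕ} (hi : 1 ≤ i) (hX : Subsingleton (ExtGroup A i X M)) (m : ℕ) :
    Subsingleton (ExtGroup A i (Fin m → X) M) := by
  induction m with
  | zero =>
    have := Module.Free.of_subsingleton A (Fin 0 → X)
    exact subsingleton_ext_of_projective _ _ hi
  | succ m ih =>
    refine subsingleton_ext_congr (Fin.consLinearEquiv A fun _ => X) hi ?_
    exact subsingleton_ext_middle (f := LinearMap.inl A X (Fin m → X)) (g := LinearMap.snd A X _)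
      LinearMap.inl_injective Function.Exact.inl_snd LinearMap.snd_surjective hX ih

end ExtVanishing

/-! ### Characters -/

section Characters

variable {X Y Z : Type*} [AddCommGroup X] [AddCommGroup Y] [AddCommGroup Z]

theorem injective_of_characters_extend (f : X →+ Y)
    (h : ∀ c : X →+ AddCircle (1 : ℚ), ∃ c' : Y →+ AddCircle (1 : ℚ), c'.comp f = c) :
    Function.Injective f := by
  refine (injective_iff_map_eq_zero f).2 fun x hx =>
    CharacterModule.eq_zero_of_character_apply fun c => ?_
  obtain ⟨c', hc'⟩ := h c
  rw [show c x = (c'.comp f) x from (DFunLike.congr_fun hc' x).symm, AddMonoidHom.comp_apply, hx,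
    map_zero]

theorem character_extends_of_injective (f : X →+ Y) (hf : Function.Injective f)
    (c : X →+ AddCircle (1 : ℚ)) : ∃ c' : Y →+ AddCircle (1 : ℚ), c'.comp f = c := by
  obtain ⟨c', hc'⟩ := CharacterModule.dual_surjective_of_injective f.toIntLinearMap hf c
  exact ⟨c', hc'⟩

/-- ℚ/ℤ is an injective cogenerator: a character killed by `f` descends to Y / ker g and extends
along its embedding into Z; conversely, characters of Y / im f separate points. -/
theorem exact_iff_characters (f : X →+ Y) (g : Y →+ Z) (hgf : g.comp f = 0) :
    Function.Exact f g ↔ ∀ c : Y →+ AddCircle (1 : ℚ), c.comp f = 0 →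
      ∃ c' : Z →+ AddCircle (1 : ℚ), c'.comp g = c := by
  constructor
  · intro hfg c hc
    have hker : g.ker ≤ c.ker := fun y hy => by
      obtain ⟨x, rfl⟩ := (hfg y).1 hy
      exact DFunLike.congr_fun hc x
    obtain ⟨c', hc'⟩ := character_extends_of_injective (QuotientAddGroup.kerLift g)
      (QuotientAddGroup.kerLift_injective g) (QuotientAddGroup.lift g.ker c hker)
    exact ⟨c', AddMonoidHom.ext fun y =>
      DFunLike.congr_fun hc' (QuotientAddGroup.mk y)⟩
  · intro h y
    refine ⟨fun hy => ?_, ?_⟩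
    · rw [← AddMonoidHom.coe_range, SetLike.mem_coe, ← QuotientAddGroup.eq_zero_iff]
      refine CharacterModule.eq_zero_of_character_apply fun c => ?_
      obtain ⟨c', hc'⟩ := h (AddMonoidHom.comp c (QuotientAddGroup.mk' f.range))
        (AddMonoidHom.ext fun x =>
          (congrArg c ((QuotientAddGroup.eq_zero_iff (N := f.range) (f x)).2 ⟨x, rfl⟩)).trans
            (map_zero c))
      have := DFunLike.congr_fun hc' y
      rw [AddMonoidHom.comp_apply, hy, map_zero] at this
      exact this.symm
    · rintro ⟨x, rfl⟩
      exact DFunLike.congr_fun hgf x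

end Characters

/-- The right `R`-module of characters `N → ℚ/ℤ` of a left `R`-module `N`. -/
def CharDual (R N : Type u) [Ring R] [AddCommGroup N] [Module R N] : Type u :=
  N →+ AddCircle (1 : ℚ)

namespace CharDual

variable {R N : Type u} [Ring R] [AddCommGroup N] [Module R N]

instance : AddCommGroup (CharDual R N) := inferInstanceAs (AddCommGroup (N →+ AddCircle (1 : ℚ)))

instance : FunLike (CharDual R N) N (AddCircle (1 : ℚ)) :=
  inferInstanceAs (FunLike (N →+ AddCircle (1 : ℚ)) N (AddCircle (1 : ℚ)))

instance : AddMonoidHomClass (CharDual R N) N (AddCircle (1 : ℚ)) :=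
  inferInstanceAs (AddMonoidHomClass (N →+ AddCircle (1 : ℚ)) N (AddCircle (1 : ℚ)))

@[ext]
theorem ext {f g : CharDual R N} (h : ∀ x, f x = g x) : f = g := DFunLike.ext _ _ h

instance : Module Rᵐᵒᵖ (CharDual R N) where
  smul r c := AddMonoidHom.comp c (Module.toAddMonoidEnd R N r.unop)
  one_smul c := ext fun x => congrArg c (one_smul R x)
  mul_smul r t c := ext fun x => congrArg c (mul_smul t.unop r.unop x)
  smul_zero _ := rfl
  smul_add _ _ _ := rfl
  add_smul r t c := ext fun x =>
    (congrArg c (add_smul r.unop t.unop x)).trans (_root_.map_add c _ _)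
  zero_smul c := ext fun x => (congrArg c (zero_smul R x)).trans (_root_.map_zero c)

variable {A B : Type u} [AddCommGroup A] [Module Rᵐᵒᵖ A] [AddCommGroup B] [Module Rᵐᵒᵖ B]

/-- A character of `A ⊗_R N` is a map of right `R`-modules from `A` to the characters of `N`. -/
def curry (c : BalTensor R A N →+ AddCircle (1 : ℚ)) : A →ₗ[Rᵐᵒᵖ] CharDual R N where
  toFun a := (AddMonoidHom.mk' (fun x => c (BalTensor.tmul R a x))
    (fun x y => by rw [BalTensor.tmul_add, map_add]) : N →+ AddCircle (1 : ℚ))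
  map_add' a b := ext fun x =>
    (congrArg c (BalTensor.add_tmul a b x)).trans (map_add c _ _)
  map_smul' r a := ext fun x => congrArg c (BalTensor.op_smul_tmul r.unop a x)

theorem balTensor_character_ext {c c' : BalTensor R A N →+ AddCircle (1 : ℚ)}
    (h : ∀ a x, c (BalTensor.tmul R a x) = c' (BalTensor.tmul R a x)) : c = c' := by
  ext x
  induction x using BalTensor.induction_on with
  | h0 => rw [map_zero, map_zero]
  | ht a x => exact h a x
  | ha x y hx hy => rw [map_add, map_add, hx, hy]

/-- The inverse of `CharDual.curry`. -/
def uncurry (φ : A →ₗ[Rᵐᵒᵖ] CharDual R N) : BalTensor R A N →+ AddCircle (1 : ℚ) :=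
  -- `BalTensor.lift` needs a target in universe `u`, hence the passage through `ULift`.
  (AddEquiv.ulift : ULift.{u} (AddCircle (1 : ℚ)) ≃+ _).toAddMonoidHom.comp <|
    BalTensor.lift
      (AddMonoidHom.mk' (fun a => AddMonoidHom.mk' (fun x => ULift.up.{u} (φ a x))
          (fun x y => congrArg ULift.up (map_add (φ a) x y)))
        (fun a b => AddMonoidHom.ext fun x =>
          congrArg ULift.up (DFunLike.congr_fun (map_add φ a b) x)))
      (fun r a x => congrArg ULift.up (DFunLike.congr_fun (map_smul φ (op r) a) x))

theorem curry_uncurry (φ : A →ₗ[Rᵐᵒᵖ] CharDual R N) : curry (uncurry φ) = φ := rfl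

theorem uncurry_curry (c : BalTensor R A N →+ AddCircle (1 : ℚ)) : uncurry (curry c) = c :=
  balTensor_character_ext fun _ _ => rfl

theorem curry_comp_map (c : BalTensor R B N →+ AddCircle (1 : ℚ)) (f : A →ₗ[Rᵐᵒᵖ] B) :
    curry (c.comp (BalTensor.map N f)) = (curry c).comp f := rfl

theorem uncurry_comp (φ : B →ₗ[Rᵐᵒᵖ] CharDual R N) (f : A →ₗ[Rᵐᵒᵖ] B) :
    uncurry (φ.comp f) = (uncurry φ).comp (BalTensor.map N f) :=
  balTensor_character_ext fun _ _ => rfl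

end CharDual

/-! ### `Tor` and `Ext` are dual -/

section TorDuality

variable {R : Type u} [Ring R] {X Y Z N : Type u} [AddCommGroup X] [Module Rᵐᵒᵖ X]
  [AddCommGroup Y] [Module Rᵐᵒᵖ Y] [AddCommGroup Z] [Module Rᵐᵒᵖ Z] [AddCommGroup N] [Module R N]

theorem balTensor_zero_tmul (n : N) : BalTensor.tmul R (0 : X) n = 0 := by
  have h := BalTensor.add_tmul (R := R) (0 : X) 0 n
  rwa [add_zero, left_eq_add] at h

theorem balTensor_map_zero : BalTensor.map N (0 : X →ₗ[Rᵐᵒᵖ] Y) = 0 :=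
  BalTensor.hom_ext fun _ n => balTensor_zero_tmul n

theorem balTensor_map_exact_iff (f : X →ₗ[Rᵐᵒᵖ] Y) (g : Y →ₗ[Rᵐᵒᵖ] Z) (hgf : g.comp f = 0) :
    Function.Exact (BalTensor.map N f) (BalTensor.map N g) ↔
      ∀ φ : Y →ₗ[Rᵐᵒᵖ] CharDual R N, φ.comp f = 0 →
        ∃ ψ : Z →ₗ[Rᵐᵒᵖ] CharDual R N, ψ.comp g = φ := by
  rw [exact_iff_characters]
  · constructor
    · intro h φ hφ
      obtain ⟨c, hc⟩ := h (CharDual.uncurry φ) (by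
        rw [← CharDual.uncurry_comp, hφ]
        exact CharDual.balTensor_character_ext fun _ _ => rfl)
      refine ⟨CharDual.curry c, ?_⟩
      rw [← CharDual.curry_comp_map, hc, CharDual.curry_uncurry]
    · intro h c hc
      obtain ⟨ψ, hψ⟩ := h (CharDual.curry c) (by
        rw [← CharDual.curry_comp_map, hc]; rfl)
      refine ⟨CharDual.uncurry ψ, ?_⟩
      rw [← CharDual.uncurry_comp, hψ, CharDual.uncurry_curry]
  · rw [← BalTensor.map_comp, hgf, balTensor_map_zero]

/-- Right exactness of the tensor product is dual to left exactness of Hom into the character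
module. -/
theorem balTensor_map_exact {f : X →ₗ[Rᵐᵒᵖ] Y} {g : Y →ₗ[Rᵐᵒᵖ] Z}
    (hfg : Function.Exact f g) (hg : Function.Surjective g) :
    Function.Exact (BalTensor.map N f) (BalTensor.map N g) :=
  (balTensor_map_exact_iff f g hfg.linearMap_comp_eq_zero).2 fun _ hφ =>
    LinearMap.exists_comp_eq_of_exact hfg hg hφ

theorem balTensor_map_surjective {g : Y →ₗ[Rᵐᵒᵖ] Z} (hg : Function.Surjective g) :
    Function.Surjective (BalTensor.map N g) := by
  intro z
  induction z using BalTensor.induction_on with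
  | h0 => exact ⟨0, map_zero _⟩
  | ht z n =>
    obtain ⟨y, rfl⟩ := hg z
    exact ⟨BalTensor.tmul R y n, rfl⟩
  | ha x y hx hy =>
    obtain ⟨x, rfl⟩ := hx
    obtain ⟨y, rfl⟩ := hy
    exact ⟨x + y, map_add _ _ _⟩

theorem balTensor_map_injective_iff (f : X →ₗ[Rᵐᵒᵖ] Y) :
    Function.Injective (BalTensor.map N f) ↔
      ∀ φ : X →ₗ[Rᵐᵒᵖ] CharDual R N, ∃ ψ : Y →ₗ[Rᵐᵒᵖ] CharDual R N, ψ.comp f = φ := by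
  constructor
  · intro hf φ
    obtain ⟨c, hc⟩ := character_extends_of_injective _ hf (CharDual.uncurry φ)
    exact ⟨CharDual.curry c, by rw [← CharDual.curry_comp_map, hc, CharDual.curry_uncurry]⟩
  · intro h
    refine injective_of_characters_extend _ fun c => ?_
    obtain ⟨ψ, hψ⟩ := h (CharDual.curry c)
    exact ⟨CharDual.uncurry ψ, by rw [← CharDual.uncurry_comp, hψ, CharDual.uncurry_curry]⟩

/-- Both sides are computed from one projective resolution P of X. Characters of P ⊗ N are maps P →
N⁺, so P ⊗ N is exact in degree i+1 precisely when every cocycle on P_(i+1) with values in N⁺ is a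
coboundary. -/
theorem isZero_tor_succ_iff (i : ℕ) :
    Limits.IsZero (TorGroup R (i + 1) X N) ↔
      Subsingleton (ExtGroup Rᵐᵒᵖ (i + 1) X (CharDual R N)) := by
  let P := projectiveResolution (ModuleCat.of Rᵐᵒᵖ X)
  have hexact : Limits.IsZero (TorGroup R (i + 1) X N) ↔
      Function.Exact (BalTensor.map N (P.complex.d (i + 2) (i + 1)).hom)
        (BalTensor.map N (P.complex.d (i + 1) i).hom) := by
    rw [TorGroup, (P.isoLeftDerivedObj (balTensorFunctor R N) (i + 1)).isZero_iff]
    change Limits.IsZero (HomologicalComplex.homology _ _) ↔ _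
    rw [← HomologicalComplex.exactAt_iff_isZero_homology,
      HomologicalComplex.exactAt_iff' _ (i + 2) (i + 1) i (by simp) (by simp),
      ShortComplex.ab_exact_iff_function_exact]
    rfl
  have hd : (P.complex.d (i + 1) i).hom.comp (P.complex.d (i + 2) (i + 1)).hom = 0 :=
    congrArg ModuleCat.Hom.hom (P.complex.d_comp_d (i + 2) (i + 1) i)
  rw [hexact, balTensor_map_exact_iff _ _ hd]
  constructor
  · intro h
    refine subsingleton_of_forall_eq 0 fun α => ?_
    obtain ⟨f, hf, rfl⟩ := P.extMk_surjective α (i + 2) rfl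
    obtain ⟨g, hg⟩ := h f.hom (congrArg ModuleCat.Hom.hom hf)
    exact (P.extMk_eq_zero_iff f _ rfl hf i rfl).2 ⟨ModuleCat.ofHom g, ModuleCat.hom_ext hg⟩
  · intro h φ hφ
    obtain ⟨g, hg⟩ := (P.extMk_eq_zero_iff (Y := ModuleCat.of Rᵐᵒᵖ (CharDual R N))
      (ModuleCat.ofHom φ) (i + 2) rfl (ModuleCat.hom_ext hφ) i rfl).1 (h.elim _ _)
    exact ⟨g.hom, congrArg ModuleCat.Hom.hom hg⟩

end TorDuality

/-! ### Finite presentations of length `n` -/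

/-- `U` is finitely generated, and is a quotient of a finitely generated free module by an
`(n - 1)`-presented submodule if `n ≥ 1`. -/
def IsRecFinPresented (A : Type u) [Ring A] :
    ℕ → ∀ (U : Type u) [AddCommGroup U] [Module A U], Prop
  | 0, U, _, _ => Module.Finite A U
  | n + 1, U, _, _ => ∃ (m : ℕ) (g : (Fin m → A) →ₗ[A] U), Function.Surjective g ∧
      IsRecFinPresented A n (LinearMap.ker g)

namespace IsRecFinPresented

variable {A : Type u} [Ring A] {n : ℕ} {X Y Z : Type u} [AddCommGroup X] [Module A X]
  [AddCommGroup Y] [Module A Y] [AddCommGroup Z] [Module A Z]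

theorem congr (e : X ≃ₗ[A] Y) (h : IsRecFinPresented A n X) : IsRecFinPresented A n Y := by
  cases n with
  | zero =>
    have : Module.Finite A X := h
    exact Module.Finite.equiv e
  | succ n =>
    obtain ⟨m, g, hg, hker⟩ := h
    refine ⟨m, e.toLinearMap.comp g, e.surjective.comp hg, ?_⟩
    rwa [LinearEquiv.ker_comp]

/-- Horseshoe construction: covers of X and Z give a cover of Y by the sum of the two free modules,
whose kernel is an extension of the two kernels. -/
theorem of_extension {f : X →ₗ[A] Y} {g : Y →ₗ[A] Z} (hf : Function.Injective f)
    (hfg : Function.Exact f g) (hg : Function.Surjective g)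
    (hX : IsRecFinPresented A n X) (hZ : IsRecFinPresented A n Z) : IsRecFinPresented A n Y := by
  induction n generalizing X Y Z with
  | zero =>
    have : Module.Finite A X := hX
    have : Module.Finite A Z := hZ
    exact Module.Finite.of_exact hfg hg
  | succ n ih =>
    obtain ⟨a, p, hp, hkp⟩ := hX
    obtain ⟨c, q, hq, hkq⟩ := hZ
    obtain ⟨h, hh⟩ := Module.projective_lifting_property g q hg
    have hgh : ∀ z, g (h z) = q z := fun z => DFunLike.congr_fun hh z
    have hgf : ∀ x, g (f x) = 0 := fun x => hfg.apply_apply_eq_zero x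
    let e : (Fin (a + c) → A) ≃ₗ[A] (Fin a → A) × (Fin c → A) :=
      (LinearEquiv.funCongrLeft A A finSumFinEquiv).trans
        (LinearEquiv.sumArrowLequivProdArrow (Fin a) (Fin c) A A)
    let r : (Fin a → A) × (Fin c → A) →ₗ[A] Y := (f.comp p).coprod h
    have hr : ∀ x z, r (x, z) = f (p x) + h z := fun x z => LinearMap.coprod_apply _ _ _
    have hrsurj : Function.Surjective r := fun y => by
      obtain ⟨z, hz⟩ := hq (g y)
      obtain ⟨x, hx⟩ := (hfg (y - h z)).1 (by rw [map_sub, hgh, hz, sub_self])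
      obtain ⟨x, rfl⟩ := hp x
      exact ⟨(x, z), by rw [hr, hx, sub_add_cancel]⟩
    refine ⟨a + c, r.comp e.toLinearMap, hrsurj.comp e.surjective, ?_⟩
    refine congr (X := LinearMap.ker r) (LinearEquiv.symm
      (e.ofSubmodules _ _ (by ext x; simp [Submodule.mem_map_equiv]))) ?_
    refine ih (f := (LinearMap.inl A _ _).restrict (p := LinearMap.ker p) fun x hx => ?_)
      (g := (LinearMap.snd A _ _).restrict (q := LinearMap.ker q) fun x hx => ?_)
      ?_ ?_ ?_ hkp hkq
    · rw [LinearMap.mem_ker] at hx ⊢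
      rw [LinearMap.inl_apply, hr, hx, map_zero, map_zero, add_zero]
    · obtain ⟨x, z⟩ := x
      rw [LinearMap.mem_ker, hr] at hx
      have hgx := congrArg g hx
      rwa [map_add, hgf, zero_add, hgh, map_zero] at hgx
    · intro x y hxy
      exact Subtype.ext (congrArg (fun t => t.1.1) hxy)
    · rintro ⟨⟨x, z⟩, hxz⟩
      constructor
      · intro hz
        obtain rfl : z = 0 := congrArg Subtype.val hz
        rw [LinearMap.mem_ker, hr, map_zero, add_zero] at hxz
        exact ⟨⟨x, hf (hxz.trans (map_zero f).symm)⟩, rfl⟩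
      · rintro ⟨y, hy⟩
        exact Subtype.ext (congrArg (fun t => t.1.2) hy).symm
    · rintro ⟨z, hz⟩
      obtain ⟨x, hx⟩ := (hfg (h z)).1 ((hgh z).trans hz)
      obtain ⟨x, rfl⟩ := hp x
      -- For `z` in ker q the lift `h z` lies in the image of `f`; the first coordinate cancels it.
      exact ⟨⟨(-x, z), by rw [LinearMap.mem_ker, hr, map_neg, map_neg, hx, neg_add_cancel]⟩, rfl⟩

/-- For a free cover `p` of Y, the kernel of `g ∘ p` is an extension of ker g ≅ X by ker p, and both
are n-presented. -/
theorem of_quotient {f : X →ₗ[A] Y} {g : Y →ₗ[A] Z} (hf : Function.Injective f)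
    (hfg : Function.Exact f g) (hg : Function.Surjective g)
    (hX : IsRecFinPresented A n X) (hY : IsRecFinPresented A (n + 1) Y) :
    IsRecFinPresented A (n + 1) Z := by
  obtain ⟨m, p, hp, hker⟩ := hY
  refine ⟨m, g.comp p, hg.comp hp, ?_⟩
  have hX' : IsRecFinPresented A n (LinearMap.ker g) :=
    congr ((LinearEquiv.ofInjective f hf).trans (LinearEquiv.ofEq _ _ hfg.linearMap_ker_eq.symm)) hX
  refine of_extension
    (f := Submodule.inclusion (LinearMap.ker_le_ker_comp p g))
    (g := p.restrict (p := LinearMap.ker (g.comp p)) (q := LinearMap.ker g) fun x hx => hx)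
    (Submodule.inclusion_injective _) ?_ ?_ hker hX'
  · rintro ⟨x, hx⟩
    constructor
    · intro h
      exact ⟨⟨x, congrArg Subtype.val h⟩, rfl⟩
    · rintro ⟨⟨y, hy⟩, h⟩
      obtain rfl : y = x := congrArg Subtype.val h
      exact Subtype.ext hy
  · rintro ⟨y, hy⟩
    obtain ⟨x, rfl⟩ := hp y
    exact ⟨⟨x, hy⟩, rfl⟩

theorem of_subsingleton [Subsingleton X] (n : ℕ) : IsRecFinPresented A n X := by
  induction n generalizing X with
  | zero => exact (inferInstance : Module.Finite A X)
  | succ n ih => exact ⟨0, 0, fun x => ⟨0, Subsingleton.elim _ _⟩, ih⟩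

/-- Frees the definition from the particular free modules `Fin m → A`. -/
theorem of_cover {F : Type u} [AddCommGroup F] [Module A F] [Module.Finite A F] [Module.Free A F]
    {g : F →ₗ[A] X} (hg : Function.Surjective g) (h : IsRecFinPresented A n (LinearMap.ker g)) :
    IsRecFinPresented A (n + 1) X := by
  have hF : IsRecFinPresented A (n + 1) F := by
    let b := Module.Free.chooseBasis A F
    let e : F ≃ₗ[A] (Fin (Fintype.card (Module.Free.ChooseBasisIndex A F)) → A) :=
      b.equivFun.trans (LinearEquiv.funCongrLeft A A (Fintype.equivFin _).symm)
    refine ⟨_, e.symm.toLinearMap, e.symm.surjective, ?_⟩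
    rw [LinearEquiv.ker]
    exact of_subsingleton n
  exact of_quotient (LinearMap.ker g).injective_subtype
    (LinearMap.exact_subtype_ker_map g) hg h hF

theorem of_ring (n : ℕ) : IsRecFinPresented A n A := by
  cases n with
  | zero => exact (inferInstance : Module.Finite A A)
  | succ n =>
    refine of_cover (g := LinearMap.id) Function.surjective_id ?_
    rw [LinearMap.ker_id]
    exact of_subsingleton n

theorem pi (h : IsRecFinPresented A n X) (m : ℕ) : IsRecFinPresented A n (Fin m → X) := by
  induction m with
  | zero => exact of_subsingleton n
  | succ m ih =>
    exact congr (Fin.consLinearEquiv A fun _ => X)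
      (of_extension (f := LinearMap.inl A X (Fin m → X)) (g := LinearMap.snd A X _)
        LinearMap.inl_injective Function.Exact.inl_snd LinearMap.snd_surjective h ih)

theorem isFinitelyNPresented (h : IsRecFinPresented A n X) : IsFinitelyNPresented A n X := by
  induction n generalizing X with
  | zero =>
    have : Module.Finite A X := h
    obtain ⟨m, p, hp⟩ := Module.Finite.exists_fin' A X
    exact ⟨fun _ => ModuleCat.of A (Fin m → A), p, fun _ => 0,
      fun _ _ => ⟨inferInstanceAs (Module.Finite A (Fin m → A)),
        inferInstanceAs (Module.Free A (Fin m → A))⟩, hp, by omega, by omega⟩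
  | succ n ih =>
    obtain ⟨m, g, hg, hker⟩ := h
    obtain ⟨F, ε, δ, hF, hε, h0, h1⟩ := ih hker
    -- Splices the sequence for ker g onto the cover `g`.
    refine ⟨fun i => Nat.casesOn i (ModuleCat.of A (Fin m → A)) F, g,
      fun i => Nat.casesOn i ((LinearMap.ker g).subtype.comp ε) δ, ?_, hg, ?_, ?_⟩
    · rintro (_ | i) hi
      · exact ⟨inferInstanceAs (Module.Finite A (Fin m → A)),
          inferInstanceAs (Module.Free A (Fin m → A))⟩
      · exact hF i (by omega)
    · intro _ x
      constructor
      · intro hx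
        obtain ⟨y, hy⟩ := hε ⟨x, hx⟩
        exact ⟨y, congrArg Subtype.val hy⟩
      · rintro ⟨y, rfl⟩
        exact (ε y).2
    · rintro (_ | i) hi x
      · exact ((LinearMap.ker g).injective_subtype.eq_iff' rfl).trans (h0 (by omega) x)
      · exact h1 i (by omega) x

end IsRecFinPresented

/-! ### Syzygies in resolutions by finitely generated free modules -/

namespace FinFreeResolution

variable {A : Type u} [Ring A] {U : Type u} [AddCommGroup U] [Module A U]

/-- The map `F_{j+1} → K_j` onto the `j`-th syzygy. -/
def toSyzygy (P : FinFreeResolution A U) : ∀ j : ℕ, P.F (j + 1) →ₗ[A] P.syzygy j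
  | 0 => (P.δ 0).codRestrict (LinearMap.ker P.ε) fun x => P.exact_zero.apply_apply_eq_zero x
  | j + 1 => (P.δ (j + 1)).codRestrict (LinearMap.ker (P.δ j))
      fun x => (P.exact_succ j).apply_apply_eq_zero x

theorem coe_toSyzygy (P : FinFreeResolution A U) (j : ℕ) (x : P.F (j + 1)) :
    (P.toSyzygy j x : P.F j) = P.δ j x := by
  cases j <;> rfl

theorem toSyzygy_surjective (P : FinFreeResolution A U) (j : ℕ) :
    Function.Surjective (P.toSyzygy j) := by
  rintro ⟨x, hx⟩
  have : ∃ y, P.δ j y = x := by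
    cases j with
    | zero => exact (P.exact_zero x).1 hx
    | succ j => exact (P.exact_succ j x).1 hx
  obtain ⟨y, hy⟩ := this
  exact ⟨y, Subtype.ext ((P.coe_toSyzygy j y).trans hy)⟩

theorem toSyzygy_eq_zero_iff (P : FinFreeResolution A U) (j : ℕ) (x : P.F (j + 1)) :
    P.toSyzygy j x = 0 ↔ P.δ j x = 0 := by
  rw [← P.coe_toSyzygy, ZeroMemClass.coe_eq_zero]

theorem exact_toSyzygy (P : FinFreeResolution A U) (j : ℕ) :
    Function.Exact (P.syzygy (j + 1)).subtype (P.toSyzygy j) := fun x => by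
  rw [toSyzygy_eq_zero_iff]
  exact ⟨fun h => ⟨⟨x, h⟩, rfl⟩, by rintro ⟨y, rfl⟩; exact y.2⟩

/-- The resolution of the `j`-th syzygy. -/
def resolutionSyzygy (P : FinFreeResolution A U) (j : ℕ) : FinFreeResolution A (P.syzygy j) where
  -- With `i` as the last summand, the index at `i + 1` is definitionally the successor of the index
  -- at `i`.
  F i := P.F (j + 1 + i)
  finite _ := P.finite _
  free _ := P.free _
  ε := P.toSyzygy j
  δ i := P.δ (j + 1 + i)
  surjective := P.toSyzygy_surjective j
  exact_zero x := (P.toSyzygy_eq_zero_iff j x).trans (P.exact_succ j x)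
  exact_succ _ := P.exact_succ _

/-- Transport of a resolution along an isomorphism. -/
def congr {V : Type u} [AddCommGroup V] [Module A V] (P : FinFreeResolution A U) (e : U ≃ₗ[A] V) :
    FinFreeResolution A V where
  F := P.F
  finite := P.finite
  free := P.free
  ε := e.toLinearMap.comp P.ε
  δ := P.δ
  surjective := e.surjective.comp P.surjective
  exact_zero x := e.map_eq_zero_iff.trans (P.exact_zero x)
  exact_succ := P.exact_succ

theorem isRecFinPresented (P : FinFreeResolution A U) (n : ℕ) : IsRecFinPresented A n U := by
  have := P.finite 0
  have := P.free 0
  induction n generalizing U with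
  | zero => exact Module.Finite.of_surjective P.ε P.surjective
  | succ n ih =>
    exact .of_cover P.surjective
      (ih (P.resolutionSyzygy 0) ((P.resolutionSyzygy 0).finite 0) ((P.resolutionSyzygy 0).free 0))

variable {M : Type u} [AddCommGroup M] [Module A M]

/-- Syzygies of `U` are again finitely presented to every order, so Ext^(d+1+k) of `U` reduces to
Ext^(d+1) of its k-fold syzygy. -/
theorem subsingleton_ext_of_le {d : ℕ}
    (h : ∀ (V : Type u) [AddCommGroup V] [Module A V], (∀ n, IsRecFinPresented A n V) →
      Subsingleton (ExtGroup A (d + 1) V M))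
    (P : FinFreeResolution A U) (k : ℕ) : Subsingleton (ExtGroup A (d + 1 + k) U M) := by
  induction k generalizing U with
  | zero => exact h U P.isRecFinPresented
  | succ k ih =>
    have := P.free 0
    exact subsingleton_ext_right (LinearMap.ker P.ε).injective_subtype
      (LinearMap.exact_subtype_ker_map P.ε) P.surjective (ih (P.resolutionSyzygy 0))
      (subsingleton_ext_of_projective _ _ (by omega))

/-- The shift is j+1 because the 0th syzygy is already the kernel of F_0 → U. -/
theorem subsingleton_ext_syzygy (P : FinFreeResolution A U) (j : ℕ) {i : ℕ} (hi : 1 ≤ i)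
    (h : Subsingleton (ExtGroup A (i + j + 1) U M)) :
    Subsingleton (ExtGroup A i (P.syzygy j) M) := by
  induction j generalizing i with
  | zero =>
    have := P.free 0
    exact subsingleton_ext_left (LinearMap.ker P.ε).injective_subtype
      (LinearMap.exact_subtype_ker_map P.ε) P.surjective
      (subsingleton_ext_of_projective _ _ hi) h
  | succ j ih =>
    have := P.free (j + 1)
    refine subsingleton_ext_left (P.syzygy (j + 1)).injective_subtype (P.exact_toSyzygy j)
      (P.toSyzygy_surjective j) (subsingleton_ext_of_projective _ _ hi) (ih (by omega) ?_)
    rwa [show i + 1 + j + 1 = i + (j + 1) + 1 by omega]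

end FinFreeResolution

/-- The (d-1)th syzygy is d kernels deep, so degree i ≥ 1 on it corresponds to degree i+d ≥ d+1 on
`U`. -/
theorem IsNDInjective.subsingleton_ext_syzygy {A : Type u} [Ring A] {n d : ℕ} (hd : 1 ≤ d)
    {M U : Type u} [AddCommGroup M] [Module A M] [AddCommGroup U] [Module A U]
    (hM : IsNDInjective A n d M) (P : FinFreeResolution A U) {i : ℕ} (hi : 1 ≤ i) :
    Subsingleton (ExtGroup A i (P.syzygy (d - 1)) M) := by
  refine P.subsingleton_ext_syzygy (d - 1) hi ?_
  have := P.subsingleton_ext_of_le (d := d) (M := M)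
    (fun V _ _ hV => hM V (hV n).isFinitelyNPresented) (i - 1)
  rwa [show i + (d - 1) + 1 = d + 1 + (i - 1) by omega]

theorem IsNDFlat.isNDInjective_charDual {R : Type u} [Ring R] {n d : ℕ} {N : Type u}
    [AddCommGroup N] [Module R N] (hN : IsNDFlat R n d N) :
    IsNDInjective Rᵐᵒᵖ n d (CharDual R N) :=
  fun U _ _ hU => (isZero_tor_succ_iff d).1 (hN U hU)

/-! ### Duals with respect to a bimodule -/

section BimoduleDual

variable {A B : Type u} [Ring A] [Ring B] {K : Type u} [AddCommGroup K] [Module A K] [Module B K]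
  [SMulCommClass A B K] {X Y Z : Type u} [AddCommGroup X] [Module A X] [AddCommGroup Y] [Module A Y]
  [AddCommGroup Z] [Module A Z]

variable (B K) in
/-- The `B`-linear map `Hom_A(Y, K) → Hom_A(X, K)` induced by `f : X → Y`. -/
def bimodPrecomp (f : X →ₗ[A] Y) : (Y →ₗ[A] K) →ₗ[B] (X →ₗ[A] K) where
  toFun g := g.comp f
  map_add' _ _ := rfl
  map_smul' _ _ := rfl

@[simp]
theorem bimodPrecomp_apply (f : X →ₗ[A] Y) (g : Y →ₗ[A] K) : bimodPrecomp B K f g = g.comp f := rfl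

theorem bimodPrecomp_injective {g : Y →ₗ[A] Z} (hg : Function.Surjective g) :
    Function.Injective (bimodPrecomp B K g) :=
  fun _ _ h => LinearMap.cancel_right hg |>.1 h

theorem bimodPrecomp_exact {f : X →ₗ[A] Y} {g : Y →ₗ[A] Z} (hfg : Function.Exact f g)
    (hg : Function.Surjective g) :
    Function.Exact (bimodPrecomp B K g) (bimodPrecomp B K f) := by
  intro φ
  constructor
  · exact LinearMap.exists_comp_eq_of_exact hfg hg
  · rintro ⟨ψ, rfl⟩
    rw [bimodPrecomp_apply, bimodPrecomp_apply, LinearMap.comp_assoc,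
      hfg.linearMap_comp_eq_zero, LinearMap.comp_zero]

/-- The obstruction to extending a map X → K to Y lies in Ext^1(Z, K). -/
theorem bimodPrecomp_surjective {f : X →ₗ[A] Y} {g : Y →ₗ[A] Z} (hf : Function.Injective f)
    (hfg : Function.Exact f g) (hg : Function.Surjective g)
    (hZ : Subsingleton (ExtGroup A 1 Z K)) : Function.Surjective (bimodPrecomp B K f) :=
  fun φ => exists_extension_of_subsingleton_ext hf hfg hg hZ φ

/-- `B ≃ Hom_A(K, K)` when the homothety map is bijective. -/
noncomputable def homothetyEquiv [SMulCommClass B A K]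
    (h : Function.Bijective (Module.toModuleEnd A K : B →+* Module.End A K)) :
    B ≃ₗ[B] (K →ₗ[A] K) :=
  LinearEquiv.ofBijective
    { toFun := fun b => (Module.toModuleEnd A K : B →+* Module.End A K) b
      map_add' := map_add _
      map_smul' := fun b c => map_mul (Module.toModuleEnd A K : B →+* Module.End A K) b c } h

theorem homothetyEquiv_one [SMulCommClass B A K]
    (h : Function.Bijective (Module.toModuleEnd A K : B →+* Module.End A K)) :
    homothetyEquiv h 1 = LinearMap.id := map_one (Module.toModuleEnd A K : B →+* Module.End A K)

theorem homothetyEquiv_apply [SMulCommClass B A K]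
    (h : Function.Bijective (Module.toModuleEnd A K : B →+* Module.End A K)) (b : B) :
    homothetyEquiv h b = b • LinearMap.id := by
  rw [← homothetyEquiv_one h, ← map_smul, smul_eq_mul, mul_one]

variable (A B K) in
/-- `X` has a resolution by finitely generated free modules, all `Ext_A^i(X, K)` with `i ≥ 1` vanish,
and `Hom_A(X, K)` is finitely `n`-presented over `B` for all `n`. -/
structure HasFinPresentedDual (X : Type u) [AddCommGroup X] [Module A X] : Prop where
  resolution : Nonempty (FinFreeResolution A X)
  ext_zero : ∀ i : ℕ, 1 ≤ i → Subsingleton (ExtGroup A i X K)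
  dual : ∀ n : ℕ, IsRecFinPresented B n (X →ₗ[A] K)

theorem isRecFinPresented_dual_of_free {F : Type u} [AddCommGroup F] [Module A F]
    [Module.Finite A F] [Module.Free A F] {n : ℕ} (hK : IsRecFinPresented B n K) :
    IsRecFinPresented B n (F →ₗ[A] K) :=
  (hK.pi _).congr (((Module.Free.chooseBasis A F).reindex (Fintype.equivFin _)).constr B)

theorem subsingleton_ext_dual_of_free {F : Type u} [AddCommGroup F] [Module A F]
    [Module.Finite A F] [Module.Free A F] {M : Type u} [AddCommGroup M] [Module B M] {i : ℕ}
    (hi : 1 ≤ i) (hM : Subsingleton (ExtGroup B i K M)) :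
    Subsingleton (ExtGroup B i (F →ₗ[A] K) M) :=
  subsingleton_ext_congr
    (((Module.Free.chooseBasis A F).reindex (Fintype.equivFin _)).constr B) hi
    (subsingleton_ext_pi hi hM _)

namespace HasFinPresentedDual

theorem of_homothety [SMulCommClass B A K] (P : FinFreeResolution A K)
    (hext : ∀ i : ℕ, 1 ≤ i → Subsingleton (ExtGroup A i K K))
    (h : Function.Bijective (Module.toModuleEnd A K : B →+* Module.End A K)) :
    HasFinPresentedDual A B K K :=
  ⟨⟨P⟩, hext, fun n => (IsRecFinPresented.of_ring n).congr (homothetyEquiv h)⟩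

/-- The dual of the kernel is the quotient of F_0*, a finite power of K, by X*, so `of_quotient`
applies. -/
theorem ker (hK : ∀ n, IsRecFinPresented B n K) (hX : HasFinPresentedDual A B K X)
    (P : FinFreeResolution A X) : HasFinPresentedDual A B K (LinearMap.ker P.ε) := by
  have := P.finite 0
  have := P.free 0
  have hinj := (LinearMap.ker P.ε).injective_subtype
  have hex := LinearMap.exact_subtype_ker_map P.ε
  refine ⟨⟨P.resolutionSyzygy 0⟩, fun i hi => subsingleton_ext_left hinj hex P.surjective
    (subsingleton_ext_of_projective _ _ hi) (hX.ext_zero (i + 1) (by omega)), fun n => ?_⟩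
  have key (n : ℕ) : IsRecFinPresented B (n + 1) (LinearMap.ker P.ε →ₗ[A] K) :=
    .of_quotient (bimodPrecomp_injective P.surjective) (bimodPrecomp_exact hex P.surjective)
      (bimodPrecomp_surjective hinj hex P.surjective (hX.ext_zero 1 le_rfl)) (hX.dual n)
      (isRecFinPresented_dual_of_free (hK _))
  cases n with
  | zero =>
    obtain ⟨m, g, hg, -⟩ := key 0
    exact Module.Finite.of_surjective g hg
  | succ n => exact key n

/-- Dualizing a resolution of X coresolves X* by powers of K, on which Ext(-, M) vanishes. Each step
trades Ext^i of X* for Ext^(i+1) of the dual of the kernel, until degree d+1 is reached. -/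
theorem subsingleton_ext_dual {M : Type u} [AddCommGroup M] [Module B M] {d : ℕ}
    (hK : ∀ n, IsRecFinPresented B n K)
    (hM : ∀ (V : Type u) [AddCommGroup V] [Module B V], (∀ n, IsRecFinPresented B n V) →
      Subsingleton (ExtGroup B (d + 1) V M))
    (hKM : ∀ i : ℕ, 1 ≤ i → Subsingleton (ExtGroup B i K M))
    (hX : HasFinPresentedDual A B K X) : Subsingleton (ExtGroup B 1 (X →ₗ[A] K) M) := by
  -- Here `e` counts the steps left from degree `i` to degree d+1.
  suffices h : ∀ (e i : ℕ), 1 ≤ i → i + e = d + 1 → Subsingleton (ExtGroup B i (X →ₗ[A] K) M) from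
    h d 1 le_rfl (add_comm 1 d)
  intro e
  induction e generalizing X with
  | zero => rintro i - rfl; exact hM _ hX.dual
  | succ e ih =>
    intro i hi hie
    obtain ⟨P⟩ := hX.resolution
    have := P.finite 0
    have := P.free 0
    have hinj := (LinearMap.ker P.ε).injective_subtype
    have hex := LinearMap.exact_subtype_ker_map P.ε
    exact subsingleton_ext_left (bimodPrecomp_injective P.surjective)
      (bimodPrecomp_exact hex P.surjective)
      (bimodPrecomp_surjective hinj hex P.surjective (hX.ext_zero 1 le_rfl))
      (subsingleton_ext_dual_of_free hi (hKM i hi)) (ih (hX.ker hK P) (i + 1) (by omega) (by omega))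

end HasFinPresentedDual

end BimoduleDual

/-! ### Tensor evaluation and the Bass class -/

section TensorEvaluation

variable {R S : Type u} [Ring R] [Ring S] {K M : Type u} [AddCommGroup K] [Module S K]
  [Module Rᵐᵒᵖ K] [SMulCommClass S Rᵐᵒᵖ K] [SMulCommClass Rᵐᵒᵖ S K] [AddCommGroup M] [Module S M]
  {X Y : Type u} [AddCommGroup X] [Module Rᵐᵒᵖ X] [AddCommGroup Y] [Module Rᵐᵒᵖ Y]

/-- The natural map `X ⊗_R Hom_S(K, M) → Hom_S(Hom_{Rᵒᵖ}(X, K), M)`, `x ⊗ f ↦ (g ↦ f (g x))`. -/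
def tensorEval (X : Type u) [AddCommGroup X] [Module Rᵐᵒᵖ X] :
    BalTensor R X (BimodHom R S K M) →+ ((X →ₗ[Rᵐᵒᵖ] K) →ₗ[S] M) :=
  BalTensor.lift
    (AddMonoidHom.mk' (fun x => AddMonoidHom.mk' (fun f =>
        { toFun := fun g => f (g x)
          map_add' := fun g h => map_add f (g x) (h x)
          map_smul' := fun s g => map_smul f s (g x) })
        (fun _ _ => rfl))
      (fun x y => AddMonoidHom.ext fun f => LinearMap.ext fun g =>
        (congrArg f (map_add g x y)).trans (map_add f _ _)))
    (fun r x f => LinearMap.ext fun g => congrArg f (map_smul g (op r) x))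

theorem tensorEval_map (f : X →ₗ[Rᵐᵒᵖ] Y) (t : BalTensor R X (BimodHom R S K M)) :
    tensorEval Y (BalTensor.map _ f t) = (tensorEval X t).comp (bimodPrecomp S K f) := by
  induction t using BalTensor.induction_on with
  | h0 => rw [map_zero, map_zero, map_zero, LinearMap.zero_comp]
  | ht x h => rfl
  | ha t t' ht ht' => rw [map_add, map_add, ht, ht', map_add, LinearMap.add_comp]

variable (R) in
/-- Composition with an `S`-linear map `K → Z`, with values in `Hom_S(K, M)`. -/
def bimodHomPrecomp {Z : Type u} [AddCommGroup Z] [Module S Z] (p : K →ₗ[S] Z) :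
    (Z →ₗ[S] M) →+ BimodHom R S K M :=
  AddMonoidHom.mk' (fun φ => φ.comp p) (fun _ _ => rfl)

/-- The map `K → Hom_A(F, K)`, `k ↦ (x ↦ c(x) k)`, for a functional `c` on `F`. -/
def bimodSMulRight {A B : Type u} [Ring A] [Ring B] {K F : Type u} [AddCommGroup K] [Module A K]
    [Module B K] [SMulCommClass A B K] [AddCommGroup F] [Module A F] (c : F →ₗ[A] A) :
    K →ₗ[B] (F →ₗ[A] K) where
  toFun k := c.smulRight k
  map_add' k l := LinearMap.ext fun x => smul_add (c x) k l
  map_smul' b k := LinearMap.ext fun x => smul_comm (c x) b k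

theorem bimodSMulRight_apply {A B : Type u} [Ring A] [Ring B] {K F : Type u} [AddCommGroup K]
    [Module A K] [Module B K] [SMulCommClass A B K] [AddCommGroup F] [Module A F] (c : F →ₗ[A] A)
    (k : K) (x : F) : bimodSMulRight (B := B) c k x = c x • k := rfl

theorem sum_bimodSMulRight {A B : Type u} [Ring A] [Ring B] {K F ι : Type u} [AddCommGroup K]
    [Module A K] [Module B K] [SMulCommClass A B K] [AddCommGroup F] [Module A F] [Fintype ι]
    (b : Module.Basis ι A F) (g : F →ₗ[A] K) :
    ∑ i, bimodSMulRight (B := B) (b.coord i) (g (b i)) = g := by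
  ext x
  rw [LinearMap.sum_apply]
  simp only [bimodSMulRight_apply, Module.Basis.coord_apply, ← map_smul, ← map_sum, b.sum_repr]

theorem balTensor_sum_tmul {R : Type u} [Ring R] {X N : Type u} {ι : Type*} [AddCommGroup X]
    [Module Rᵐᵒᵖ X] [AddCommGroup N] [Module R N] (s : Finset ι) (f : ι → X) (n : N) :
    BalTensor.tmul R (∑ i ∈ s, f i) n = ∑ i ∈ s, BalTensor.tmul R (f i) n :=
  map_sum (AddMonoidHom.mk' (fun x : X => BalTensor.tmul R x n)
    (fun a b => BalTensor.add_tmul a b n)) f s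

theorem tensorEval_bijective_of_free (F : Type u) [AddCommGroup F] [Module Rᵐᵒᵖ F]
    [Module.Finite Rᵐᵒᵖ F] [Module.Free Rᵐᵒᵖ F] :
    Function.Bijective (tensorEval (R := R) (S := S) (K := K) (M := M) F) := by
  let b := Module.Free.chooseBasis Rᵐᵒᵖ F
  -- Dual basis formula: φ is sent to the sum of b_i ⊗ (k ↦ φ(b_i^* · k)).
  let inv : ((F →ₗ[Rᵐᵒᵖ] K) →ₗ[S] M) →+ BalTensor R F (BimodHom R S K M) :=
    ∑ i, AddMonoidHom.mk' (fun φ =>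
        BalTensor.tmul R (b i) (bimodHomPrecomp R (bimodSMulRight (b.coord i)) φ))
      (fun φ ψ => by rw [map_add, BalTensor.tmul_add])
  have hinv (φ) : inv φ =
      ∑ i, BalTensor.tmul R (b i) (bimodHomPrecomp R (bimodSMulRight (b.coord i)) φ) := by
    simp only [inv, AddMonoidHom.finsetSum_apply, AddMonoidHom.mk'_apply]
  refine Function.bijective_iff_has_inverse.2 ⟨inv, fun t => ?_, fun φ => ?_⟩
  · induction t using BalTensor.induction_on with
    | h0 => rw [map_zero, map_zero]
    | ht x f =>
      have hx : x = ∑ i, b.coord i x • b i := (b.sum_repr x).symm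
      conv_rhs => rw [hx]
      rw [balTensor_sum_tmul, hinv]
      exact Finset.sum_congr rfl fun i _ => (BalTensor.op_smul_tmul (b.coord i x).unop (b i) f).symm
    | ha t t' ht ht' => rw [map_add, map_add, ht, ht']
  · ext g
    rw [hinv, map_sum, LinearMap.sum_apply]
    exact (map_sum φ _ _).symm.trans (congrArg φ (sum_bimodSMulRight b g))

namespace HasFinPresentedDual

variable (hK : ∀ n, IsRecFinPresented S n K)
  (hM : ∀ X : Type u, ∀ [AddCommGroup X] [Module Rᵐᵒᵖ X], HasFinPresentedDual Rᵐᵒᵖ S K X →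
    Subsingleton (ExtGroup S 1 (X →ₗ[Rᵐᵒᵖ] K) M))

include hK hM

/-- As Ext^1 of the dual of the kernel vanishes, a map X* → M extends to F_0*, where the free case
applies. -/
theorem tensorEval_surjective (hX : HasFinPresentedDual Rᵐᵒᵖ S K X) :
    Function.Surjective (tensorEval (R := R) (S := S) (K := K) (M := M) X) := by
  intro φ
  obtain ⟨P⟩ := hX.resolution
  have := P.finite 0
  have := P.free 0
  have hinj := (LinearMap.ker P.ε).injective_subtype
  have hex := LinearMap.exact_subtype_ker_map P.ε
  obtain ⟨ψ, hψ⟩ := exists_extension_of_subsingleton_ext (bimodPrecomp_injective P.surjective)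
      (bimodPrecomp_exact hex P.surjective)
      (bimodPrecomp_surjective hinj hex P.surjective (hX.ext_zero 1 le_rfl))
      (hM _ (hX.ker hK P)) φ
  obtain ⟨t, rfl⟩ := (tensorEval_bijective_of_free (P.F 0)).2 ψ
  exact ⟨BalTensor.map _ P.ε t, (tensorEval_map P.ε t).trans hψ⟩

theorem tensorEval_injective (hX : HasFinPresentedDual Rᵐᵒᵖ S K X) :
    Function.Injective (tensorEval (R := R) (S := S) (K := K) (M := M) X) := by
  refine (injective_iff_map_eq_zero _).2 fun t ht => ?_
  obtain ⟨P⟩ := hX.resolution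
  have := P.finite 0
  have := P.free 0
  have hinj := (LinearMap.ker P.ε).injective_subtype
  have hex := LinearMap.exact_subtype_ker_map P.ε
  obtain ⟨t, rfl⟩ := balTensor_map_surjective P.surjective t
  rw [tensorEval_map] at ht
  -- The functional on F_0* vanishes on X*, so it factors through the dual of the kernel;
  -- surjectivity for the kernel then shows that `t` comes from the kernel and dies in X ⊗ Hom(K,
  -- M).
  obtain ⟨χ, hχ⟩ := LinearMap.exists_comp_eq_of_exact (bimodPrecomp_exact hex P.surjective)
    (bimodPrecomp_surjective hinj hex P.surjective (hX.ext_zero 1 le_rfl)) ht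
  obtain ⟨s, rfl⟩ := (hX.ker hK P).tensorEval_surjective hK hM χ
  have hs : BalTensor.map _ (LinearMap.ker P.ε).subtype s = t :=
    (tensorEval_bijective_of_free (P.F 0)).1 ((tensorEval_map _ s).trans hχ)
  rw [← hs]
  exact (balTensor_map_exact hex P.surjective).apply_apply_eq_zero s

theorem balTensor_map_injective (hX : HasFinPresentedDual Rᵐᵒᵖ S K X)
    (P : FinFreeResolution Rᵐᵒᵖ X) :
    Function.Injective (BalTensor.map (BimodHom R S K M) (LinearMap.ker P.ε).subtype) := by
  have hinj := (LinearMap.ker P.ε).injective_subtype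
  have hex := LinearMap.exact_subtype_ker_map P.ε
  intro s t hst
  have h := congrArg (tensorEval (P.F 0)) hst
  rw [tensorEval_map, tensorEval_map] at h
  exact (hX.ker hK P).tensorEval_injective hK hM ((LinearMap.cancel_right
    (bimodPrecomp_surjective hinj hex P.surjective (hX.ext_zero 1 le_rfl))).1 h)

/-- This is Tor_i(X, Hom(K, M)) = 0 in dual form, so that dimension shifting can be done with Ext.
-/
theorem subsingleton_ext_charDual (hX : HasFinPresentedDual Rᵐᵒᵖ S K X) {i : ℕ} (hi : 1 ≤ i) :
    Subsingleton (ExtGroup Rᵐᵒᵖ i X (CharDual R (BimodHom R S K M))) := by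
  induction i, hi using Nat.le_induction generalizing X with
  | base =>
    obtain ⟨P⟩ := hX.resolution
    have := P.free 0
    exact subsingleton_ext_one_of_exists_extension (LinearMap.ker P.ε).injective_subtype
      (LinearMap.exact_subtype_ker_map P.ε) P.surjective
      (subsingleton_ext_of_projective _ _ le_rfl)
      ((balTensor_map_injective_iff _).1 (hX.balTensor_map_injective hK hM P))
  | succ i hi ih =>
    obtain ⟨P⟩ := hX.resolution
    have := P.free 0
    exact subsingleton_ext_right (LinearMap.ker P.ε).injective_subtype
      (LinearMap.exact_subtype_ker_map P.ε) P.surjective (ih (hX.ker hK P))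
      (subsingleton_ext_of_projective _ _ (by omega))

end HasFinPresentedDual

/-- Hom(K, K) is free over `S` on the identity, so evaluation there identifies Hom(K*, M) with M and
carries `tensorEval` to `bassMap`. -/
theorem bassMap_bijective
    (hS : Function.Bijective (Module.toModuleEnd Rᵐᵒᵖ K : S →+* Module.End Rᵐᵒᵖ K))
    (hK : Function.Bijective (tensorEval (R := R) (S := S) (K := K) (M := M) K)) :
    Function.Bijective (bassMap R S K M) := by
  have hev : Function.Bijective fun φ : (K →ₗ[Rᵐᵒᵖ] K) →ₗ[S] M => φ LinearMap.id := by
    constructor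
    · intro φ ψ h
      refine LinearMap.ext fun g => ?_
      obtain ⟨s, rfl⟩ := (homothetyEquiv hS).surjective g
      rw [homothetyEquiv_apply, map_smul, map_smul]
      exact congrArg (s • ·) h
    · intro m
      refine ⟨(LinearMap.toSpanSingleton S M m).comp (homothetyEquiv hS).symm.toLinearMap, ?_⟩
      change (homothetyEquiv hS).symm LinearMap.id • m = m
      rw [← homothetyEquiv_one hS, LinearEquiv.symm_apply_apply, one_smul]
  have heq : ⇑(bassMap R S K M) = (fun φ : (K →ₗ[Rᵐᵒᵖ] K) →ₗ[S] M => φ LinearMap.id) ∘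
      tensorEval (R := R) (S := S) (K := K) (M := M) K := by
    funext t
    induction t using BalTensor.induction_on with
    | h0 => rw [map_zero, Function.comp_apply, map_zero, LinearMap.zero_apply]
    | ht x f => rfl
    | ha t t' ht ht' =>
      rw [map_add, ht, ht', Function.comp_apply, Function.comp_apply, Function.comp_apply, map_add,
        LinearMap.add_apply]
  rw [heq]
  exact hev.comp hK

end TensorEvaluation

/-! ### Hom evaluation and the Auslander class -/

section HomEvaluation

variable {R S : Type u} [Ring R] [Ring S] {K N : Type u} [AddCommGroup K] [Module S K]
  [Module Rᵐᵒᵖ K] [SMulCommClass S Rᵐᵒᵖ K] [AddCommGroup N] [Module R N]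
  {X Y : Type u} [AddCommGroup X] [Module S X] [AddCommGroup Y] [Module S Y]

/-- The natural map `Hom_S(X, K) ⊗_R N → Hom_S(X, K ⊗_R N)`, `g ⊗ n ↦ (x ↦ g x ⊗ n)`. -/
def homEval (X : Type u) [AddCommGroup X] [Module S X] :
    BalTensor R (X →ₗ[S] K) N →+ (X →ₗ[S] BalTensor R K N) :=
  BalTensor.lift
    (AddMonoidHom.mk' (fun g => AddMonoidHom.mk' (fun n =>
        { toFun := fun x => BalTensor.tmul R (g x) n
          map_add' := fun x y => by rw [map_add, BalTensor.add_tmul]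
          map_smul' := fun s x => by rw [map_smul, RingHom.id_apply, BalTensor.smul_tmul] })
        (fun n n' => LinearMap.ext fun x => BalTensor.tmul_add (g x) n n'))
      (fun g h => AddMonoidHom.ext fun n => LinearMap.ext fun x => BalTensor.add_tmul (g x) (h x) n))
    (fun r g n => LinearMap.ext fun x => BalTensor.op_smul_tmul r (g x) n)

theorem homEval_map (f : X →ₗ[S] Y) (t : BalTensor R (Y →ₗ[S] K) N) :
    homEval X (BalTensor.map N (bimodPrecomp Rᵐᵒᵖ K f) t) = (homEval Y t).comp f := by
  induction t using BalTensor.induction_on with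
  | h0 => rw [map_zero, map_zero, map_zero, LinearMap.zero_comp]
  | ht x h => rfl
  | ha t t' ht ht' => rw [map_add, map_add, ht, ht', map_add, LinearMap.add_comp]

theorem homEval_map_bimodSMulRight (c : X →ₗ[S] S) (t : BalTensor R K N) (x : X) :
    homEval X (BalTensor.map N (bimodSMulRight (B := Rᵐᵒᵖ) c) t) x = c x • t := by
  induction t using BalTensor.induction_on with
  | h0 => rw [map_zero, map_zero, LinearMap.zero_apply, smul_zero]
  | ht k n => rfl
  | ha t t' ht ht' => rw [map_add, map_add, LinearMap.add_apply, ht, ht', smul_add]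

theorem homEval_bijective_of_free (F : Type u) [AddCommGroup F] [Module S F]
    [Module.Finite S F] [Module.Free S F] :
    Function.Bijective (homEval (R := R) (S := S) (K := K) (N := N) F) := by
  let b := Module.Free.chooseBasis S F
  let inv (φ : F →ₗ[S] BalTensor R K N) : BalTensor R (F →ₗ[S] K) N :=
    ∑ i, BalTensor.map N (bimodSMulRight (B := Rᵐᵒᵖ) (b.coord i)) (φ (b i))
  refine Function.bijective_iff_has_inverse.2 ⟨inv, fun t => ?_, fun φ => ?_⟩
  · induction t using BalTensor.induction_on with
    | h0 => exact Finset.sum_eq_zero fun i _ => by rw [map_zero, LinearMap.zero_apply, map_zero]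
    | ht g n =>
      conv_rhs => rw [← sum_bimodSMulRight (B := Rᵐᵒᵖ) b g]
      rw [balTensor_sum_tmul]
      rfl
    | ha t t' ht ht' =>
      have hadd (φ ψ : F →ₗ[S] BalTensor R K N) : inv (φ + ψ) = inv φ + inv ψ := by
        simp only [inv, LinearMap.add_apply, map_add, Finset.sum_add_distrib]
      rw [map_add, hadd, ht, ht']
  · ext x
    rw [map_sum, LinearMap.sum_apply]
    simp only [homEval_map_bimodSMulRight, Module.Basis.coord_apply, ← map_smul, ← map_sum,
      b.sum_repr]

namespace HasFinPresentedDual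

variable (hK : ∀ n, IsRecFinPresented Rᵐᵒᵖ n K)
  (hN : ∀ X : Type u, ∀ [AddCommGroup X] [Module S X], HasFinPresentedDual S Rᵐᵒᵖ K X →
    Subsingleton (ExtGroup Rᵐᵒᵖ 1 (X →ₗ[S] K) (CharDual R N)))

include hK hN

/-- By duality, injectivity means that maps X* → N⁺ extend to F_0*; the obstruction lies in Ext^1 of
the dual of the kernel. -/
theorem map_bimodPrecomp_injective (hX : HasFinPresentedDual S Rᵐᵒᵖ K X)
    (P : FinFreeResolution S X) :
    Function.Injective (BalTensor.map N (bimodPrecomp Rᵐᵒᵖ K P.ε)) := by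
  have hinj := (LinearMap.ker P.ε).injective_subtype
  have hex := LinearMap.exact_subtype_ker_map P.ε
  exact (balTensor_map_injective_iff _).2 (exists_extension_of_subsingleton_ext
    (bimodPrecomp_injective P.surjective) (bimodPrecomp_exact hex P.surjective)
    (bimodPrecomp_surjective hinj hex P.surjective (hX.ext_zero 1 le_rfl)) (hN _ (hX.ker hK P)))

theorem homEval_injective (hX : HasFinPresentedDual S Rᵐᵒᵖ K X) :
    Function.Injective (homEval (R := R) (S := S) (K := K) (N := N) X) := by
  obtain ⟨P⟩ := hX.resolution
  have := P.finite 0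
  have := P.free 0
  intro s t hst
  refine hX.map_bimodPrecomp_injective hK hN P ((homEval_bijective_of_free (P.F 0)).1 ?_)
  rw [homEval_map, homEval_map, hst]

theorem homEval_surjective (hX : HasFinPresentedDual S Rᵐᵒᵖ K X) :
    Function.Surjective (homEval (R := R) (S := S) (K := K) (N := N) X) := by
  intro φ
  obtain ⟨P⟩ := hX.resolution
  have := P.finite 0
  have := P.free 0
  have hinj := (LinearMap.ker P.ε).injective_subtype
  have hex := LinearMap.exact_subtype_ker_map P.ε
  obtain ⟨t, ht⟩ := (homEval_bijective_of_free (P.F 0)).2 (φ.comp P.ε)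
  -- `φ ∘ ε` vanishes on the kernel, and `homEval` is injective there; right exactness then descends
  -- `t` to X* ⊗ N.
  have ht0 : BalTensor.map N (bimodPrecomp Rᵐᵒᵖ K (LinearMap.ker P.ε).subtype) t = 0 := by
    refine (hX.ker hK P).homEval_injective hK hN ?_
    rw [homEval_map, ht, map_zero, LinearMap.comp_assoc, hex.linearMap_comp_eq_zero,
      LinearMap.comp_zero]
  obtain ⟨s, rfl⟩ := (balTensor_map_exact (bimodPrecomp_exact hex P.surjective)
    (bimodPrecomp_surjective hinj hex P.surjective (hX.ext_zero 1 le_rfl)) t).1 ht0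
  rw [homEval_map] at ht
  exact ⟨s, (LinearMap.cancel_right P.surjective).1 ht⟩

/-- Every map from the kernel to K ⊗ N comes from its dual tensored with N, onto which F_0* ⊗ N
surjects; so the map extends to F_0 and Ext^1 vanishes. -/
theorem subsingleton_ext_balTensor (hX : HasFinPresentedDual S Rᵐᵒᵖ K X) {i : ℕ} (hi : 1 ≤ i) :
    Subsingleton (ExtGroup S i X (BalTensor R K N)) := by
  induction i, hi using Nat.le_induction generalizing X with
  | base =>
    obtain ⟨P⟩ := hX.resolution
    have := P.free 0
    have hinj := (LinearMap.ker P.ε).injective_subtype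
    have hex := LinearMap.exact_subtype_ker_map P.ε
    refine subsingleton_ext_one_of_exists_extension hinj hex P.surjective
      (subsingleton_ext_of_projective _ _ le_rfl) fun φ => ?_
    obtain ⟨s, rfl⟩ := (hX.ker hK P).homEval_surjective hK hN φ
    obtain ⟨t, rfl⟩ := balTensor_map_surjective
      (bimodPrecomp_surjective hinj hex P.surjective (hX.ext_zero 1 le_rfl)) s
    exact ⟨homEval _ t, (homEval_map _ t).symm⟩
  | succ i hi ih =>
    obtain ⟨P⟩ := hX.resolution
    have := P.free 0
    exact subsingleton_ext_right (LinearMap.ker P.ε).injective_subtype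
      (LinearMap.exact_subtype_ker_map P.ε) P.surjective (ih (hX.ker hK P))
      (subsingleton_ext_of_projective _ _ (by omega))

end HasFinPresentedDual

theorem auslanderMap_bijective [SMulCommClass Rᵐᵒᵖ S K]
    (hR : Function.Bijective (Module.toModuleEnd S K : Rᵐᵒᵖ →+* Module.End S K))
    (hK : Function.Bijective (homEval (R := R) (S := S) (K := K) (N := N) K)) :
    Function.Bijective (auslanderMap R S K N) := by
  let e := homothetyEquiv hR
  let c : BalTensor R (K →ₗ[S] K) N →+ N := BalTensor.lift
    (AddMonoidHom.mk' (fun g => AddMonoidHom.mk' (fun n => (e.symm g).unop • n)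
        (fun n n' => smul_add _ n n'))
      (fun g h => AddMonoidHom.ext fun n =>
        (congrArg (fun r : Rᵐᵒᵖ => r.unop • n) (map_add e.symm g h)).trans (add_smul _ _ n)))
    (fun r g n => (congrArg (fun r : Rᵐᵒᵖ => r.unop • n) (map_smul e.symm (op r) g)).trans
      (mul_smul (e.symm g).unop r n))
  have hid : Function.Bijective fun n : N => BalTensor.tmul R (LinearMap.id : K →ₗ[S] K) n := by
    refine Function.bijective_iff_has_inverse.2 ⟨c, fun n => ?_, fun t => ?_⟩
    · change (e.symm LinearMap.id).unop • n = n
      rw [← homothetyEquiv_one hR, LinearEquiv.symm_apply_apply, unop_one, one_smul]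
    · induction t using BalTensor.induction_on with
      | h0 =>
        have h := BalTensor.tmul_add (R := R) (LinearMap.id : K →ₗ[S] K) (0 : N) 0
        rw [add_zero, left_eq_add] at h
        rwa [map_zero]
      | ht g n =>
        obtain ⟨r, rfl⟩ := e.surjective g
        change BalTensor.tmul R LinearMap.id ((e.symm (e r)).unop • n) = _
        rw [LinearEquiv.symm_apply_apply, ← BalTensor.op_smul_tmul, op_unop]
        exact congrArg (fun g => BalTensor.tmul R g n) (homothetyEquiv_apply hR r).symm
      | ha t t' ht ht' =>
        rw [map_add]
        exact (BalTensor.tmul_add _ _ _).trans (congrArg₂ (· + ·) ht ht')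
  -- `homEval` sends id ⊗ n to k ↦ k ⊗ n, so this composite is `auslanderMap` by definition.
  exact hK.comp hid

end HomEvaluation

/-! ### Membership in the Bass and Auslander classes -/

theorem IsSpecialSemidualizing.memBass {R S : Type u} [Ring R] [Ring S] {n d : ℕ} (hd : 1 ≤ d)
    {C K M : Type u}
    [AddCommGroup C] [Module S C] [Module Rᵐᵒᵖ C] [SMulCommClass S Rᵐᵒᵖ C]
    [AddCommGroup K] [Module S K] [Module Rᵐᵒᵖ K] [SMulCommClass S Rᵐᵒᵖ K]
    [AddCommGroup M] [Module S M]
    (hK : IsSpecialSemidualizing R S d C K) (hM : IsNDInjective S n d M) : MemBass R S K M := by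
  have := SMulCommClass.symm S Rᵐᵒᵖ K
  obtain ⟨P, ⟨eP⟩⟩ := hK.left_syzygy
  obtain ⟨Q, ⟨eQ⟩⟩ := hK.right_syzygy
  -- The resolution over `S` controls Ext(K, M) and the duals; the one over `Rᵐᵒᵖ` makes K a good
  -- right module.
  have hfin := ((P.resolutionSyzygy (d - 1)).congr eP.symm).isRecFinPresented
  have hext (i : ℕ) (hi : 1 ≤ i) : Subsingleton (ExtGroup S i K M) :=
    subsingleton_ext_congr eP.symm hi (hM.subsingleton_ext_syzygy hd P hi)
  have hdual : HasFinPresentedDual Rᵐᵒᵖ S K K :=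
    .of_homothety ((Q.resolutionSyzygy (d - 1)).congr eQ.symm) hK.semidualizing.right_ext
      hK.semidualizing.left_homothety
  have hvanish (X : Type u) [AddCommGroup X] [Module Rᵐᵒᵖ X]
      (hX : HasFinPresentedDual Rᵐᵒᵖ S K X) : Subsingleton (ExtGroup S 1 (X →ₗ[Rᵐᵒᵖ] K) M) :=
    hX.subsingleton_ext_dual hfin (fun V _ _ hV => hM V (hV n).isFinitelyNPresented) hext
  refine ⟨hext, fun i hi => ?_, bassMap_bijective hK.semidualizing.left_homothety
    ⟨hdual.tensorEval_injective hfin hvanish, hdual.tensorEval_surjective hfin hvanish⟩⟩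
  obtain ⟨i, rfl⟩ := Nat.exists_eq_add_of_le' hi
  exact (isZero_tor_succ_iff i).2 (hdual.subsingleton_ext_charDual hfin hvanish hi)

theorem IsSpecialSemidualizing.memAuslander {R S : Type u} [Ring R] [Ring S] {n d : ℕ} (hd : 1 ≤ d)
    {C K N : Type u}
    [AddCommGroup C] [Module S C] [Module Rᵐᵒᵖ C] [SMulCommClass S Rᵐᵒᵖ C]
    [AddCommGroup K] [Module S K] [Module Rᵐᵒᵖ K] [SMulCommClass S Rᵐᵒᵖ K]
    [AddCommGroup N] [Module R N]
    (hK : IsSpecialSemidualizing R S d C K) (hN : IsNDFlat R n d N) : MemAuslander R S K N := by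
  have := SMulCommClass.symm S Rᵐᵒᵖ K
  obtain ⟨P, ⟨eP⟩⟩ := hK.left_syzygy
  obtain ⟨Q, ⟨eQ⟩⟩ := hK.right_syzygy
  have hN' := hN.isNDInjective_charDual
  have hfin := ((Q.resolutionSyzygy (d - 1)).congr eQ.symm).isRecFinPresented
  have hext (i : ℕ) (hi : 1 ≤ i) : Subsingleton (ExtGroup Rᵐᵒᵖ i K (CharDual R N)) :=
    subsingleton_ext_congr eQ.symm hi (hN'.subsingleton_ext_syzygy hd Q hi)
  have hdual : HasFinPresentedDual S Rᵐᵒᵖ K K :=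
    .of_homothety ((P.resolutionSyzygy (d - 1)).congr eP.symm) hK.semidualizing.left_ext
      hK.semidualizing.right_homothety
  have hvanish (X : Type u) [AddCommGroup X] [Module S X] (hX : HasFinPresentedDual S Rᵐᵒᵖ K X) :
      Subsingleton (ExtGroup Rᵐᵒᵖ 1 (X →ₗ[S] K) (CharDual R N)) :=
    hX.subsingleton_ext_dual hfin (fun V _ _ hV => hN' V (hV n).isFinitelyNPresented) hext
  refine ⟨fun i hi => ?_, fun i hi => hdual.subsingleton_ext_balTensor hfin hvanish hi,
    auslanderMap_bijective hK.semidualizing.right_homothety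
      ⟨hdual.homEval_injective hfin hvanish, hdual.homEval_surjective hfin hvanish⟩⟩
  obtain ⟨i, rfl⟩ := Nat.exists_eq_add_of_le' hi
  -- Tor_i(K, N) vanishes because K is a syzygy of C and N⁺ is (n,d)-injective.
  exact (isZero_tor_succ_iff i).2 (hext (i + 1) hi)

theorem theorem3 {R S : Type u} [Ring R] [Ring S] {n d : ℕ} (hd : 1 ≤ d) (hn : d + 1 < n)
    {C K : Type u}
    [AddCommGroup C] [Module S C] [Module Rᵐᵒᵖ C] [SMulCommClass S Rᵐᵒᵖ C]
    [AddCommGroup K] [Module S K] [Module Rᵐᵒᵖ K] [SMulCommClass S Rᵐᵒᵖ K]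
    (hK : IsSpecialSemidualizing R S d C K) :
    (∀ (M : Type u) [AddCommGroup M] [Module S M],
        IsNDInjective S n d M → MemBass R S K M) ∧
    (∀ (N : Type u) [AddCommGroup N] [Module R N],
        IsNDFlat R n d N → MemAuslander R S K N) :=
  ⟨fun _ _ _ hM => hK.memBass hd hM, fun _ _ _ hN => hK.memAuslander hd hN⟩
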